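/- **Proposition 3.18.** Let $T$ be the set of finite rooted binary trees whose leaves are labelled by positive integers; write $t_1t_2$ for the tree with left subtree $t_1$ and right subtree $t_2$. Let $A$ be the partial operator on $T$ that maps each tree $t_1(t_2t_3)$ to $(t_1t_2)t_3$, and $C$ the partial operator that maps each tree $t_1t_2$ to $t_2t_1$. For each address $\alpha$ (a finite word over $\{0,1\}$, read as a path from the root, $0$ meaning left and $1$ right), let $A_\alpha$ (resp. $C_\alpha$) be the partial operator that applies $A$ (resp. $C$) to the subtree at $\alpha$, when this is possible. Let $\mathcal G(\mathcal A,\mathcal C)$ be the monoid of partial injections of $T$ generated by all $A_\alpha^{\pm1}$, $C_\alpha^{\pm1}$, where $fg$ means "$f$, then $g$". Call $g,g'$ near-equal if both are defined at some common tree and they agree at every tree where both are defined. Near-equality is a congruence on $\mathcal G(\mathcal A,\mathcal C)$ and the quotient is a group $G(\mathcal A,\mathcal C)$; the classes of $A_\alpha$, $C_\alpha$ are still denoted $A_\alpha$, $C_\alpha$. Let $R_{AC}$ be the following list of relations, where $\gamma,\alpha,\beta$ range over all addresses and each of $X,Y$ is $A$ or $C$: - geometric relations: $X_{\gamma0\alpha}Y_{\gamma1\beta}=Y_{\gamma1\beta}X_{\gamma0\alpha}$;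 $X_{\gamma11\alpha}A_\gamma=A_\gamma X_{\gamma1\alpha}$, $\;X_{\gamma10\alpha}A_\gamma=A_\gamma X_{\gamma01\alpha}$, $\;X_{\gamma0\alpha}A_\gamma=A_\gamma X_{\gamma00\alpha}$; $X_{\gamma0\alpha}C_\gamma=C_\gamma X_{\gamma1\alpha}$, $\;X_{\gamma1\alpha}C_\gamma=C_\gamma X_{\gamma0\alpha}$; - pentagon relations: $A_\gamma A_\gamma=A_{\gamma1}A_\gamma A_{\gamma0}$; - hexagon relations: $A_\gamma C_\gamma A_\gamma=C_{\gamma1}A_\gamma C_{\gamma0}$ and $A_\gamma^{-1}C_\gamma A_\gamma^{-1}=C_{\gamma0}A_\gamma^{-1}C_{\gamma1}$. Then the relations $R_{AC}$ together with the torsion relations $C_\alpha^2=1$, for all addresses $\alpha$, make a presentation of the group $G(\mathcal A,\mathcal C)$ in terms of the generators $A_\alpha$ and $C_\alpha$: mapping each letter to the element with the same name induces an isomorphism from the presented group onto $G(\mathcal A,\mathcal C)$. Moreover $G(\mathcal A,\mathcal C)$ is Thompson's group $V$, so this is a presentation of $V$. Here $V$ is the group, under composition, of those permutations of the set $\{0,1\}^{\mathbb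 N}$ of infinite binary sequences for which there is an $N$ such that every word $u$ of length $N$ has a substitute word $v$ with $ux\mapsto vx$ for all $x$; and there is an isomorphism $\Phi: G(\mathcal A,\mathcal C)\to V$ such that, whenever $g\in\mathcal G(\mathcal A,\mathcal C)$ maps a tree $t$ to a tree $t'$, the permutation $\Phi(\bar g)$ maps the dyadic partition given by $t'$ to the one given by $t$, in the following sense: for each sequence $x$, if the path $x$ in $t'$ reaches a leaf labelled $i$ with remaining sequence $y$, then the path $\Phi(\bar g)(x)$ in $t$ reaches a leaf labelled $i$ with the same remaining sequence $y$. -/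

import Mathlib

/-! ### Coloured trees and partial operators -/

/-- Finite rooted binary trees whose leaves wear labels that are positive integers:
`FreeMagma.of x` is the one-leaf tree with label `x`, and `FreeMagma.mul t₁ t₂` (also written
`t₁ * t₂`) is the tree with left subtree `t₁` and right subtree `t₂`. -/
abbrev CTree : Type := FreeMagma ℕ+

/-- Binary addresses; `false` stands for `0` (left) and `true` for `1` (right). -/
abbrev Address : Type := List Bool

namespace CTree

theorem node_inj {a b c d : CTree} : a * b = c * d ↔ a = c ∧ b = d :=
  ⟨fun h => by injection h with h₁ h₂; exact ⟨h₁, h₂⟩, fun h => by rw [h.1, h.2]⟩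

theorem node_ne_leaf {x : ℕ+} {a b : CTree} : a * b ≠ FreeMagma.of x := nofun

/-- The associativity operator, mapping every tree `t₁(t₂t₃)` to `(t₁t₂)t₃`. -/
def assoc : CTree ≃. CTree where
  toFun
    | .mul t₁ (.mul t₂ t₃) => some (.mul (.mul t₁ t₂) t₃)
    | _ => none
  invFun
    | .mul (.mul t₁ t₂) t₃ => some (.mul t₁ (.mul t₂ t₃))
    | _ => none
  inv := by
    rintro (x | ⟨a, (y | ⟨b, c⟩)⟩) (z | ⟨(w | ⟨d, e⟩), f⟩) <;>
      simp [node_inj, node_ne_leaf]; all_goals grind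

/-- The commutativity operator, mapping every tree `t₁t₂` to `t₂t₁`. -/
def comm : CTree ≃. CTree where
  toFun
    | .mul t₁ t₂ => some (.mul t₂ t₁)
    | .of _ => none
  invFun
    | .mul t₁ t₂ => some (.mul t₂ t₁)
    | .of _ => none
  inv := by
    rintro (x | ⟨a, b⟩) (z | ⟨c, d⟩) <;>
      simp [node_inj, node_ne_leaf]; all_goals grind

/-- Application of a partial operator to the left subtree. -/
def onLeft (f : CTree ≃. CTree) : CTree ≃. CTree where
  toFun
    | .mul t₁ t₂ => (f t₁).map fun s => .mul s t₂
    | .of _ => none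
  invFun
    | .mul t₁ t₂ => (f.symm t₁).map fun s => .mul s t₂
    | .of _ => none
  inv := by
    rintro (x | ⟨a, b⟩) (z | ⟨c, d⟩) <;>
      simp [PEquiv.eq_some_iff, node_inj]; all_goals grind

/-- Application of a partial operator to the right subtree. -/
def onRight (f : CTree ≃. CTree) : CTree ≃. CTree where
  toFun
    | .mul t₁ t₂ => (f t₂).map fun s => .mul t₁ s
    | .of _ => none
  invFun
    | .mul t₁ t₂ => (f.symm t₂).map fun s => .mul t₁ s
    | .of _ => none
  inv := by
    rintro (x | ⟨a, b⟩) (z | ⟨c, d⟩) <;>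
      simp [PEquiv.eq_some_iff, node_inj]; all_goals grind

/-- The `α`-shift of a partial operator: it is applied to the `α`-subtree, when this exists. -/
def shift (f : CTree ≃. CTree) : Address → (CTree ≃. CTree)
  | [] => f
  | false :: α => onLeft (shift f α)
  | true :: α => onRight (shift f α)

end CTree

/-- Partial injections of the set of coloured trees form a monoid under reversed composition:
`f * g` is `f` followed by `g`. -/
instance CTree.instMonoidPEquiv : Monoid (CTree ≃. CTree) where
  mul f g := f.trans g
  one := PEquiv.refl CTree
  mul_assoc f g h := PEquiv.trans_assoc f g h
  one_mul f := PEquiv.refl_trans f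
  mul_one f := PEquiv.trans_refl f

/-- The two families of generators: `A` (associativity) and `C` (commutativity). -/
inductive Law : Type
  | A
  | C
  deriving DecidableEq

/-- The basic operator of each law. -/
def Law.operator : Law → (CTree ≃. CTree)
  | .A => CTree.assoc
  | .C => CTree.comm

/-- The operators `A_α` and `C_α`. -/
def lawOp (X : Law) (α : Address) : CTree ≃. CTree := CTree.shift X.operator α

/-- The geometry monoid of associativity and commutativity: the monoid generated by all
operators `A_α`, `C_α` and their inverses. -/
def GeometryMonoid : Submonoid (CTree ≃. CTree) :=
  Submonoid.closure {f | ∃ X α, f = lawOp X α ∨ f = (lawOp X α).symm}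

/-- Near-equality of partial mappings: they are both defined at some common tree, and they agree
at every tree where both are defined. -/
def NearEq (g g' : CTree ≃. CTree) : Prop :=
  (∃ t, (g t).isSome ∧ (g' t).isSome) ∧
    ∀ t, (g t).isSome → (g' t).isSome → g t = g' t

/-! ### Near-equality is a congruence on the geometry monoid, with a group as quotient -/

namespace CTree

theorem mul_eq_some {f g : CTree ≃. CTree} {t u : CTree} :
    (f * g) t = some u ↔ ∃ s, f t = some s ∧ g s = some u :=
  PEquiv.trans_eq_some f g t u

/-- Compatibility with substitutions. -/
def Equivariant (f : CTree ≃. CTree) : Prop :=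
  ∀ (σ : ℕ+ → CTree) (t s : CTree), f t = some s →
    f (FreeMagma.lift σ t) = some (FreeMagma.lift σ s)

/-- The minimal depth of a leaf. -/
def minDepth : CTree → ℕ
  | .of _ => 0
  | .mul a b => min (minDepth a) (minDepth b) + 1

/-- The operator is defined on all trees that are deep enough, with a deep image. -/
def DeepDom (f : CTree ≃. CTree) : Prop :=
  ∃ N, ∀ n t, N + n ≤ minDepth t → ∃ s, f t = some s ∧ n ≤ minDepth s

theorem Equivariant.symm {f : CTree ≃. CTree} (h : Equivariant f) : Equivariant f.symm := by
  intro σ t s hts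
  rw [PEquiv.eq_some_iff] at hts ⊢
  exact h σ s t hts

theorem equivariant_assoc : Equivariant assoc := by
  rintro σ (x | ⟨a, (y | ⟨b, c⟩)⟩) s h
  · cases h
  · cases h
  · cases h; rfl

theorem equivariant_comm : Equivariant comm := by
  rintro σ (x | ⟨a, b⟩) s h
  · cases h
  · cases h; rfl

theorem Equivariant.onLeft {f : CTree ≃. CTree} (h : Equivariant f) : Equivariant (onLeft f) := by
  rintro σ (x | ⟨a, b⟩) s hs
  · cases hs
  · change (f a).map _ = _ at hs
    obtain ⟨u, hu, rfl⟩ := Option.map_eq_some_iff.1 hs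
    change (f (FreeMagma.lift σ a)).map _ = _
    rw [h σ a u hu]; rfl

theorem Equivariant.onRight {f : CTree ≃. CTree} (h : Equivariant f) :
    Equivariant (onRight f) := by
  rintro σ (x | ⟨a, b⟩) s hs
  · cases hs
  · change (f b).map _ = _ at hs
    obtain ⟨u, hu, rfl⟩ := Option.map_eq_some_iff.1 hs
    change (f (FreeMagma.lift σ b)).map _ = _
    rw [h σ b u hu]; rfl

theorem onLeft_symm (f : CTree ≃. CTree) : (onLeft f).symm = onLeft f.symm := rfl

theorem onRight_symm (f : CTree ≃. CTree) : (onRight f).symm = onRight f.symm := rfl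

theorem shift_symm (f : CTree ≃. CTree) (α : Address) : (shift f α).symm = shift f.symm α := by
  induction α with
  | nil => rfl
  | cons b α ih => cases b <;> simp [shift, onLeft_symm, onRight_symm, ih]

theorem Equivariant.shift {f : CTree ≃. CTree} (h : Equivariant f) (α : Address) :
    Equivariant (shift f α) := by
  induction α with
  | nil => exact h
  | cons b α ih => cases b <;> [exact ih.onLeft; exact ih.onRight]

theorem deepDom_assoc : DeepDom assoc := by
  refine ⟨2, ?_⟩
  rintro n (x | ⟨a, (y | ⟨b, c⟩)⟩) h
  · simp [minDepth] at h
  · simp [minDepth] at h; omega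
  · exact ⟨_, rfl, by simp only [minDepth] at h ⊢; omega⟩

theorem deepDom_assoc_symm : DeepDom assoc.symm := by
  refine ⟨2, ?_⟩
  rintro n (x | ⟨(y | ⟨b, c⟩), a⟩) h
  · simp [minDepth] at h
  · simp [minDepth] at h; omega
  · exact ⟨_, rfl, by simp only [minDepth] at h ⊢; omega⟩

theorem deepDom_comm : DeepDom comm := by
  refine ⟨1, ?_⟩
  rintro n (x | ⟨a, b⟩) h
  · simp [minDepth] at h
  · exact ⟨_, rfl, by simp only [minDepth] at h ⊢; omega⟩

theorem DeepDom.onLeft {f : CTree ≃. CTree} (h : DeepDom f) : DeepDom (onLeft f) := by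
  obtain ⟨N, hN⟩ := h
  refine ⟨N + 1, ?_⟩
  rintro n (x | ⟨a, b⟩) h
  · simp [minDepth] at h
  · simp only [minDepth] at h
    obtain ⟨s, hs, hn⟩ := hN n a (by omega)
    refine ⟨.mul s b, ?_, by simp only [minDepth]; omega⟩
    change (f a).map _ = _
    rw [hs]; rfl

theorem DeepDom.onRight {f : CTree ≃. CTree} (h : DeepDom f) : DeepDom (onRight f) := by
  obtain ⟨N, hN⟩ := h
  refine ⟨N + 1, ?_⟩
  rintro n (x | ⟨a, b⟩) h
  · simp [minDepth] at h
  · simp only [minDepth] at h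
    obtain ⟨s, hs, hn⟩ := hN n b (by omega)
    refine ⟨.mul a s, ?_, by simp only [minDepth]; omega⟩
    change (f b).map _ = _
    rw [hs]; rfl

theorem DeepDom.shift {f : CTree ≃. CTree} (h : DeepDom f) (α : Address) :
    DeepDom (shift f α) := by
  induction α with
  | nil => exact h
  | cons b α ih => cases b <;> [exact ih.onLeft; exact ih.onRight]

theorem equivariant_of_mem {g : CTree ≃. CTree} (hg : g ∈ GeometryMonoid) : Equivariant g := by
  induction hg using Submonoid.closure_induction with
  | mem f hf =>
    obtain ⟨X, α, rfl | rfl⟩ := hf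
    · cases X <;> [exact equivariant_assoc.shift α; exact equivariant_comm.shift α]
    · cases X <;> [exact (equivariant_assoc.shift α).symm; exact (equivariant_comm.shift α).symm]
  | one => intro σ t s h; cases h; rfl
  | mul f g _ _ hf hg =>
    intro σ t s h
    obtain ⟨u, hu, hs⟩ := mul_eq_some.1 h
    exact mul_eq_some.2 ⟨_, hf σ t u hu, hg σ u s hs⟩

theorem deepDom_of_mem {g : CTree ≃. CTree} (hg : g ∈ GeometryMonoid) : DeepDom g := by
  induction hg using Submonoid.closure_induction with
  | mem f hf =>
    obtain ⟨X, α, rfl | rfl⟩ := hf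
    · cases X <;> [exact deepDom_assoc.shift α; exact deepDom_comm.shift α]
    · rw [lawOp, shift_symm]
      cases X <;> [exact deepDom_assoc_symm.shift α; exact deepDom_comm.shift α]
  | one => exact ⟨0, fun n t h => ⟨t, rfl, by omega⟩⟩
  | mul f g _ _ hf hg =>
    obtain ⟨N, hN⟩ := hf
    obtain ⟨M, hM⟩ := hg
    refine ⟨N + M, fun n t h => ?_⟩
    obtain ⟨s, hs, hs'⟩ := hN (M + n) t (by omega)
    obtain ⟨u, hu, hu'⟩ := hM n s hs'
    exact ⟨u, mul_eq_some.2 ⟨s, hs, hu⟩, hu'⟩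

/-- The full binary tree of depth `n` with all labels equal to `x`. -/
def full : ℕ → ℕ+ → CTree
  | 0, x => .of x
  | n + 1, x => .mul (full n x) (full n x)

theorem minDepth_full (n : ℕ) (x : ℕ+) : minDepth (full n x) = n := by
  induction n with
  | zero => rfl
  | succ n ih => simp [full, minDepth, ih]

theorem full_injective (n : ℕ) : Function.Injective (full n) := by
  induction n with
  | zero => intro x y h; cases h; rfl
  | succ n ih =>
    intro x y h
    rw [full, full] at h
    injection h with h₁ _
    exact ih h₁

theorem le_minDepth_lift (n : ℕ) (t : CTree) : n ≤ minDepth (FreeMagma.lift (full n) t) := by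
  induction t with
  | of x => simp [minDepth_full]
  | mul a b ha hb =>
    change n ≤ min (minDepth (FreeMagma.lift (full n) a))
      (minDepth (FreeMagma.lift (full n) b)) + 1
    omega

theorem lift_full_injective (n : ℕ) :
    Function.Injective fun t : CTree => FreeMagma.lift (full n) t := by
  have key : ∀ (x : ℕ+) (a b : CTree),
      full n x ≠ .mul (FreeMagma.lift (full n) a) (FreeMagma.lift (full n) b) := by
    intro x a b h
    have h₁ := congrArg minDepth h
    have h₂ := le_minDepth_lift n a
    have h₃ := le_minDepth_lift n b
    simp only [minDepth_full, minDepth] at h₁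
    omega
  intro t
  induction t with
  | of x =>
    rintro (y | ⟨a, b⟩) h
    · exact congrArg FreeMagma.of (full_injective n h)
    · exact absurd h (key x a b)
  | mul c d hc hd =>
    rintro (y | ⟨a, b⟩) h
    · exact absurd h.symm (key y c d)
    · injection h with h₁ h₂
      rw [hc h₁, hd h₂]

theorem exists_common {f g : CTree ≃. CTree} (hf : f ∈ GeometryMonoid) (hg : g ∈ GeometryMonoid) :
    ∃ t, (f t).isSome ∧ (g t).isSome := by
  obtain ⟨N, hN⟩ := deepDom_of_mem hf
  obtain ⟨M, hM⟩ := deepDom_of_mem hg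
  obtain ⟨s, hs, -⟩ := hN 0 (full (N + M) 1) (by rw [minDepth_full]; omega)
  obtain ⟨u, hu, -⟩ := hM 0 (full (N + M) 1) (by rw [minDepth_full]; omega)
  exact ⟨full (N + M) 1, by simp [hs], by simp [hu]⟩

theorem nearEq_trans {f g h : CTree ≃. CTree} (hf : f ∈ GeometryMonoid) (hg : g ∈ GeometryMonoid)
    (hh : h ∈ GeometryMonoid) (h₁ : NearEq f g) (h₂ : NearEq g h) : NearEq f h := by
  refine ⟨exists_common hf hh, fun t ht ht' => ?_⟩
  obtain ⟨u, hu⟩ := Option.isSome_iff_exists.1 ht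
  obtain ⟨v, hv⟩ := Option.isSome_iff_exists.1 ht'
  obtain ⟨N, hN⟩ := deepDom_of_mem hg
  obtain ⟨w, hw, -⟩ := hN 0 (FreeMagma.lift (full N) t) (le_minDepth_lift N t)
  have hu' := equivariant_of_mem hf (full N) t u hu
  have hv' := equivariant_of_mem hh (full N) t v hv
  have e₁ := h₁.2 (FreeMagma.lift (full N) t) (by simp [hu']) (by simp [hw])
  have e₂ := h₂.2 (FreeMagma.lift (full N) t) (by simp [hw]) (by simp [hv'])
  rw [hu', e₂, hv'] at e₁
  rw [hu, hv, lift_full_injective N (Option.some.inj e₁)]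

end CTree

/-- Near-equality, as a congruence on the geometry monoid. -/
def nearEqCon : Con GeometryMonoid where
  r g g' := NearEq g g'
  iseqv :=
    { refl := fun g => ⟨CTree.exists_common g.2 g.2, fun _ _ _ => rfl⟩
      symm := fun h => ⟨h.1.imp fun _ ht => ⟨ht.2, ht.1⟩, fun t ht ht' => (h.2 t ht' ht).symm⟩
      trans := fun {f g h} h₁ h₂ => CTree.nearEq_trans f.2 g.2 h.2 h₁ h₂ }
  mul' := by
    intro f f' g g' hf hg
    refine ⟨CTree.exists_common (f * g).2 (f' * g').2, fun t ht ht' => ?_⟩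
    obtain ⟨u, hu⟩ := Option.isSome_iff_exists.1 ht
    obtain ⟨v, hv⟩ := Option.isSome_iff_exists.1 ht'
    rw [hu, hv]
    obtain ⟨r, hr, hu⟩ := CTree.mul_eq_some.1 hu
    obtain ⟨s, hs, hv⟩ := CTree.mul_eq_some.1 hv
    have e := hf.2 t (by simp [hr]) (by simp [hs])
    rw [hr, hs] at e
    cases e
    have e := hg.2 r (by simp [hu]) (by simp [hv])
    rwa [hu, hv] at e

theorem symm_mem_geometryMonoid {g : CTree ≃. CTree} (hg : g ∈ GeometryMonoid) :
    g.symm ∈ GeometryMonoid := by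
  induction hg using Submonoid.closure_induction with
  | mem f hf =>
    obtain ⟨X, α, rfl | rfl⟩ := hf
    · exact Submonoid.subset_closure ⟨X, α, Or.inr rfl⟩
    · exact Submonoid.subset_closure ⟨X, α, Or.inl rfl⟩
  | one => exact one_mem GeometryMonoid
  | mul f g _ _ hf hg => exact mul_mem hg hf

theorem nearEq_symm_mul {g : CTree ≃. CTree} (hg : g ∈ GeometryMonoid) :
    NearEq (g.symm * g) 1 := by
  refine ⟨CTree.exists_common (mul_mem (symm_mem_geometryMonoid hg) hg) (one_mem _),
    fun t ht _ => ?_⟩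
  obtain ⟨u, hu⟩ := Option.isSome_iff_exists.1 ht
  rw [hu]
  obtain ⟨s, hs, hu⟩ := CTree.mul_eq_some.1 hu
  rw [PEquiv.eq_some_iff, hu] at hs
  exact hs

/-- The geometry group of associativity and commutativity: the quotient of the geometry monoid
by near-equality. -/
abbrev GeometryGroup : Type := nearEqCon.Quotient

theorem GeometryGroup.exists_left_inv (a : GeometryGroup) : ∃ b : GeometryGroup, b * a = 1 := by
  induction a using Con.induction_on with
  | H g =>
    exact ⟨((⟨(g : CTree ≃. CTree).symm, symm_mem_geometryMonoid g.2⟩ : GeometryMonoid) :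
      GeometryGroup), (Con.eq nearEqCon).2 (nearEq_symm_mul g.2)⟩

noncomputable instance GeometryGroup.instGroup : Group GeometryGroup :=
  { (inferInstance : Monoid GeometryGroup) with
    inv := fun a => (GeometryGroup.exists_left_inv a).choose
    inv_mul_cancel := fun a => (GeometryGroup.exists_left_inv a).choose_spec }

/-- The class in the geometry group of an element of the geometry monoid. -/
def GeometryGroup.mk (g : GeometryMonoid) : GeometryGroup := nearEqCon.mk' g

/-- The elements `A_α` and `C_α` of the geometry group. -/
def GeometryGroup.gen (X : Law) (α : Address) : GeometryGroup :=
  GeometryGroup.mk ⟨lawOp X α, Submonoid.subset_closure ⟨X, α, Or.inl rfl⟩⟩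

/-! ### The relations -/

/-- The letter `X_α` in the free group on all `A_α` and `C_α`. -/
def letter (X : Law) (α : Address) : FreeGroup (Law × Address) := FreeGroup.of (X, α)

/-- The geometric relations, i.e., all translated copies (by an address `γ`) of the commutation
relations for incompatible addresses, and of the inheritance relations under `A` and `C`.
`GeometricRel u v` is the relation `u = v`. -/
inductive GeometricRel : FreeGroup (Law × Address) → FreeGroup (Law × Address) → Prop
  | perp (X Y : Law) (γ α β : Address) : GeometricRel
      (letter X (γ ++ false :: α) * letter Y (γ ++ true :: β))
      (letter Y (γ ++ true :: β) * letter X (γ ++ false :: α))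
  | assoc_right (X : Law) (γ α : Address) : GeometricRel
      (letter X (γ ++ true :: true :: α) * letter .A γ)
      (letter .A γ * letter X (γ ++ true :: α))
  | assoc_middle (X : Law) (γ α : Address) : GeometricRel
      (letter X (γ ++ true :: false :: α) * letter .A γ)
      (letter .A γ * letter X (γ ++ false :: true :: α))
  | assoc_left (X : Law) (γ α : Address) : GeometricRel
      (letter X (γ ++ false :: α) * letter .A γ)
      (letter .A γ * letter X (γ ++ false :: false :: α))
  | comm_left (X : Law) (γ α : Address) : GeometricRel
      (letter X (γ ++ false :: α) * letter .C γ)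
      (letter .C γ * letter X (γ ++ true :: α))
  | comm_right (X : Law) (γ α : Address) : GeometricRel
      (letter X (γ ++ true :: α) * letter .C γ)
      (letter .C γ * letter X (γ ++ false :: α))

/-- The pentagon relations `A_γ A_γ = A_{γ1} A_γ A_{γ0}`. -/
inductive PentagonRel : FreeGroup (Law × Address) → FreeGroup (Law × Address) → Prop
  | pentagon (γ : Address) : PentagonRel
      (letter .A γ * letter .A γ)
      (letter .A (γ ++ [true]) * letter .A γ * letter .A (γ ++ [false]))

/-- The hexagon relations `A_γ C_γ A_γ = C_{γ1} A_γ C_{γ0}` and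
`A_γ⁻¹ C_γ A_γ⁻¹ = C_{γ0} A_γ⁻¹ C_{γ1}`. -/
inductive HexagonRel : FreeGroup (Law × Address) → FreeGroup (Law × Address) → Prop
  | pos (γ : Address) : HexagonRel
      (letter .A γ * letter .C γ * letter .A γ)
      (letter .C (γ ++ [true]) * letter .A γ * letter .C (γ ++ [false]))
  | neg (γ : Address) : HexagonRel
      ((letter .A γ)⁻¹ * letter .C γ * (letter .A γ)⁻¹)
      (letter .C (γ ++ [false]) * (letter .A γ)⁻¹ * letter .C (γ ++ [true]))

/-- The family `R_AC`: geometric, pentagon and hexagon relations, each relation `u = v` being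
written as the relator `u v⁻¹`. -/
def relatorsAC : Set (FreeGroup (Law × Address)) :=
  {r | ∃ u v, (GeometricRel u v ∨ PentagonRel u v ∨ HexagonRel u v) ∧ r = u * v⁻¹}

/-- The torsion relations `C_α² = 1`. -/
def torsionRelators : Set (FreeGroup (Law × Address)) :=
  {r | ∃ α, r = letter .C α ^ 2}

/-! ### Thompson's group V -/

open scoped Stream' in
/-- Thompson's group `V`, as the group of all permutations `g` of the Cantor space `{0,1}^ℕ` of
infinite binary sequences that act by replacing a finite prefix, the prefix to be replaced and its
substitute being given by a finite table: for some `N`, each word `u` of length `N` has a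
substitute `v` with `g (u x) = v x` for all `x`. (An infinite sequence encodes a point of `[0,1)`
in base two, and this is the usual group of piecewise linear dyadic bijections.) Multiplication is
composition of maps. -/
def ThompsonV : Subgroup (Equiv.Perm (Stream' Bool)) where
  carrier := {g | ∃ N : ℕ, ∀ u : List Bool, u.length = N →
    ∃ v : List Bool, ∀ x : Stream' Bool, g (u ++ₛ x) = v ++ₛ x}
  one_mem' := ⟨0, fun u _ => ⟨u, fun _ => rfl⟩⟩
  mul_mem' := by
    rintro h g ⟨M, hM⟩ ⟨N, hN⟩
    refine ⟨N + M, fun u hu => ?_⟩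
    obtain ⟨v, hv⟩ := hN (u.take N) (by simp; omega)
    obtain ⟨w, hw⟩ := hM ((v ++ u.drop N).take M) (by simp; omega)
    refine ⟨w ++ (v ++ u.drop N).drop M, fun x => ?_⟩
    have e : u ++ₛ x = u.take N ++ₛ (u.drop N ++ₛ x) := by
      rw [← Stream'.append_append_stream, List.take_append_drop]
    rw [Equiv.Perm.mul_apply, e, hv, ← Stream'.append_append_stream,
      ← List.take_append_drop M (v ++ u.drop N), Stream'.append_append_stream, hw,
      ← Stream'.append_append_stream, List.take_append_drop]
  inv_mem' := by
    rintro g ⟨N, hN⟩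
    choose v hv using hN
    have hfin : {u : List Bool | u.length = N}.Finite := List.finite_length_eq Bool N
    obtain ⟨M, hM⟩ : ∃ M, ∀ (u : List Bool) (hu : u.length = N), (v u hu).length ≤ M := by
      have := hfin.to_subtype
      obtain ⟨M, hM⟩ := (Set.finite_range fun u : {u : List Bool | u.length = N} =>
        (v u.1 u.2).length).bddAbove
      exact ⟨M, fun u hu => hM ⟨⟨u, hu⟩, rfl⟩⟩
    refine ⟨M, fun w hw => ?_⟩
    set y : Stream' Bool := g⁻¹ (w ++ₛ Stream'.const false) with hy
    have hl : (y.take N).length = N := Stream'.length_take N y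
    have hgy : v _ hl ++ₛ y.drop N = w ++ₛ Stream'.const false := by
      rw [← hv, Stream'.append_take_drop, hy, ← Equiv.Perm.mul_apply, mul_inv_cancel, Equiv.Perm.one_apply]
    have hle := hM _ hl
    have hpre : w = v _ hl ++ w.drop (v _ hl).length := by
      have h₁ := congrArg (Stream'.take (v _ hl).length) hgy
      rw [Stream'.take_append_of_le_length _ _ _ le_rfl,
        Stream'.take_append_of_le_length _ _ _ (by omega), List.take_length] at h₁
      conv_lhs => rw [← List.take_append_drop (v _ hl).length w, ← h₁]
    refine ⟨y.take N ++ w.drop (v _ hl).length, fun x => ?_⟩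
    rw [Equiv.Perm.inv_eq_iff_eq, Stream'.append_append_stream, hv _ hl,
      ← Stream'.append_append_stream, ← hpre]

/-- A tree induces a dyadic partition of the Cantor space, with one piece for each leaf:
`CTree.locate t x` is the label of the leaf of `t` that is reached by following the path `x`
from the root, together with the part of `x` that has not been used. -/
def CTree.locate : CTree → Stream' Bool → ℕ+ × Stream' Bool
  | .of i, x => (i, x)
  | .mul t₁ t₂, x => if x.head then locate t₂ x.tail else locate t₁ x.tail

/-!
The presented group maps onto the geometry group because the relations hold between the operators,
all of them as equalities of partial injections except `C_α² = 1`, which is a near-equality. The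
converse is a coherence theorem, proved with a normal form. Normalize a tree with pairwise distinct
labels as in merge sort: normalize both subtrees to right combs with increasing labels, then merge
the two combs. Performing this in the presented group gives an element `normalizer t` for each tree
`t`. If every generator satisfies `normalizer t = X_α * normalizer t'` when `X_α` maps `t` to `t'`
(`ACGroup.normalizer_lawOp`), then the same holds for every element `w` of the presented group and
an operator that realizes it, so that `w = 1` as soon as this operator fixes one tree in its domain.

For an address other than the root, the identity is inherited from a subtree; for `C` at the root
it holds by the geometric relations and the symmetry `merge S T = C * merge T S` of merging. For `A`
at the root, it says that merging three combs is associative (`ACGroup.mergeAssoc`). When the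
smallest label lies in the first comb, it is split off by the pentagon relation. The other two cases
reduce to this one by permuting the combs, which costs the hexagon relation and its consequence
`(AC)³ = 1`, a form of the braid relation.

A path through a tree `t` leads to a leaf, and this turns an operator into a permutation of the
sequences: if `g` maps `t` to `t'`, the permutation sends the piece of a leaf of `t'` to the piece
of the leaf of `t` with the same label. One tree with distinct labels determines the permutation, which
gives a homomorphism from the geometry group to `V`. It is injective since a tree is determined by
the map `locate`. It is surjective since an element of `V` given by a table on words of length `N`
sends the partition of a full tree of depth `N` to that of another tree with the same leaves, and
since two trees with the same leaves are in the same orbit of the geometry monoid, the orbits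
forming a commutative semigroup.
-/

/-! ### The presented group and its shift endomorphisms -/

/-- The group presented by the relations `R_AC` and the torsion relations. -/
abbrev ACGroup : Type := PresentedGroup (relatorsAC ∪ torsionRelators)

namespace ACGroup

/-- The generator `X_α` of the presented group. -/
def of (X : Law) (α : Address) : ACGroup := PresentedGroup.of (X, α)

theorem mk_eq_of_rel {u v : FreeGroup (Law × Address)}
    (h : GeometricRel u v ∨ PentagonRel u v ∨ HexagonRel u v) :
    PresentedGroup.mk (relatorsAC ∪ torsionRelators) u = PresentedGroup.mk _ v :=
  mul_inv_eq_one.1 <| by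
    rw [← map_inv, ← map_mul]
    exact PresentedGroup.one_of_mem (Or.inl ⟨u, v, h, rfl⟩)

theorem perp (X Y : Law) (γ α β : Address) :
    of X (γ ++ false :: α) * of Y (γ ++ true :: β) =
      of Y (γ ++ true :: β) * of X (γ ++ false :: α) :=
  mk_eq_of_rel (Or.inl (.perp X Y γ α β))

theorem assoc_right (X : Law) (γ α : Address) :
    of X (γ ++ true :: true :: α) * of .A γ = of .A γ * of X (γ ++ true :: α) :=
  mk_eq_of_rel (Or.inl (.assoc_right X γ α))

theorem assoc_middle (X : Law) (γ α : Address) :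
    of X (γ ++ true :: false :: α) * of .A γ = of .A γ * of X (γ ++ false :: true :: α) :=
  mk_eq_of_rel (Or.inl (.assoc_middle X γ α))

theorem assoc_left (X : Law) (γ α : Address) :
    of X (γ ++ false :: α) * of .A γ = of .A γ * of X (γ ++ false :: false :: α) :=
  mk_eq_of_rel (Or.inl (.assoc_left X γ α))

theorem comm_left (X : Law) (γ α : Address) :
    of X (γ ++ false :: α) * of .C γ = of .C γ * of X (γ ++ true :: α) :=
  mk_eq_of_rel (Or.inl (.comm_left X γ α))

theorem comm_right (X : Law) (γ α : Address) :
    of X (γ ++ true :: α) * of .C γ = of .C γ * of X (γ ++ false :: α) :=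
  mk_eq_of_rel (Or.inl (.comm_right X γ α))

theorem pentagon (γ : Address) :
    of .A γ * of .A γ = of .A (γ ++ [true]) * of .A γ * of .A (γ ++ [false]) :=
  mk_eq_of_rel (Or.inr (Or.inl (.pentagon γ)))

theorem hexagon_pos (γ : Address) :
    of .A γ * of .C γ * of .A γ = of .C (γ ++ [true]) * of .A γ * of .C (γ ++ [false]) :=
  mk_eq_of_rel (Or.inr (Or.inr (.pos γ)))

theorem hexagon_neg (γ : Address) :
    (of .A γ)⁻¹ * of .C γ * (of .A γ)⁻¹ =
      of .C (γ ++ [false]) * (of .A γ)⁻¹ * of .C (γ ++ [true]) :=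
  mk_eq_of_rel (Or.inr (Or.inr (.neg γ)))

theorem comm_mul_self (γ : Address) : of .C γ * of .C γ = 1 := by
  rw [← sq]
  exact PresentedGroup.one_of_mem (rels := relatorsAC ∪ torsionRelators) (Or.inr ⟨γ, rfl⟩)

/-- A map from the generators to a group that respects the defining relations kills all
relators. -/
theorem lift_relator_eq_one {G : Type*} [Group G] {f : Law × Address → G}
    (hgeo : ∀ u v, GeometricRel u v → FreeGroup.lift f u = FreeGroup.lift f v)
    (hpent : ∀ u v, PentagonRel u v → FreeGroup.lift f u = FreeGroup.lift f v)
    (hhex : ∀ u v, HexagonRel u v → FreeGroup.lift f u = FreeGroup.lift f v)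
    (htor : ∀ α, f (.C, α) * f (.C, α) = 1) :
    ∀ r ∈ relatorsAC ∪ torsionRelators, FreeGroup.lift f r = 1 := by
  rintro r (⟨u, v, h, rfl⟩ | ⟨α, rfl⟩)
  · rw [map_mul, map_inv, mul_inv_eq_one]
    rcases h with h | h | h
    exacts [hgeo u v h, hpent u v h, hhex u v h]
  · simpa [letter, sq] using htor α

/-- The endomorphism mapping each generator `X_α` to `X_{bα}`, which exists since the defining
relations are closed under translation of addresses. -/
def shift (b : Bool) : ACGroup →* ACGroup :=
  PresentedGroup.toGroup (f := fun p => of p.1 (b :: p.2)) <| by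
    refine lift_relator_eq_one ?_ ?_ ?_ fun α => comm_mul_self _
    · rintro u v h
      cases h <;> simp only [map_mul, letter, FreeGroup.lift_apply_of]
      exacts [perp _ _ (b :: _) _ _, assoc_right _ (b :: _) _, assoc_middle _ (b :: _) _,
        assoc_left _ (b :: _) _, comm_left _ (b :: _) _, comm_right _ (b :: _) _]
    · rintro u v h
      cases h
      simp only [map_mul, letter, FreeGroup.lift_apply_of]
      exact pentagon (b :: _)
    · rintro u v h
      cases h <;> simp only [map_mul, map_inv, letter, FreeGroup.lift_apply_of]
      exacts [hexagon_pos (b :: _), hexagon_neg (b :: _)]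

@[simp]
theorem shift_of (b : Bool) (X : Law) (α : Address) : shift b (of X α) = of X (b :: α) :=
  PresentedGroup.toGroup.of _

/-- A semiconjugation relation between two endomorphisms holds as soon as it holds on
generators. -/
theorem semiconjBy_of_gen {a : ACGroup} {f g : ACGroup →* ACGroup}
    (h : ∀ X α, g (of X α) * a = a * f (of X α)) (w : ACGroup) : g w * a = a * f w := by
  have key : (MulAut.conj a).toMonoidHom.comp f = g :=
    PresentedGroup.ext fun ⟨X, α⟩ => by
      change a * f (of X α) * a⁻¹ = g (of X α)
      rw [← h, mul_inv_cancel_right]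
  rw [← key]
  exact inv_mul_cancel_right _ _

/-- The generator `A` at the root. -/
abbrev rootA : ACGroup := of .A []

/-- The generator `C` at the root. -/
abbrev rootC : ACGroup := of .C []

theorem shift_mul_shift (w w' : ACGroup) :
    shift false w * shift true w' = shift true w' * shift false w := by
  refine semiconjBy_of_gen (f := shift false) (g := shift false) (fun X α => ?_) w
  refine (semiconjBy_of_gen (f := shift true) (g := shift true) (fun Y β => ?_) w').symm
  simpa using (perp X Y [] α β).symm

theorem shift_right_mul_rootA (w : ACGroup) :
    shift true (shift true w) * rootA = rootA * shift true w :=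
  semiconjBy_of_gen (f := shift true) (g := (shift true).comp (shift true))
    (fun X α => by simpa using assoc_right X [] α) w

theorem shift_middle_mul_rootA (w : ACGroup) :
    shift true (shift false w) * rootA = rootA * shift false (shift true w) :=
  semiconjBy_of_gen (f := (shift false).comp (shift true)) (g := (shift true).comp (shift false))
    (fun X α => by simpa using assoc_middle X [] α) w

theorem shift_left_mul_rootA (w : ACGroup) :
    shift false w * rootA = rootA * shift false (shift false w) :=
  semiconjBy_of_gen (f := (shift false).comp (shift false)) (g := shift false)
    (fun X α => by simpa using assoc_left X [] α) w

theorem shift_left_mul_rootC (w : ACGroup) : shift false w * rootC = rootC * shift true w :=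
  semiconjBy_of_gen (fun X α => by simpa using comm_left X [] α) w

theorem shift_right_mul_rootC (w : ACGroup) : shift true w * rootC = rootC * shift false w :=
  semiconjBy_of_gen (fun X α => by simpa using comm_right X [] α) w

theorem rootA_mul_rootA : rootA * rootA = shift true rootA * rootA * shift false rootA := by
  simpa using pentagon []

theorem rootA_rootC_rootA :
    rootA * rootC * rootA = shift true rootC * rootA * shift false rootC := by
  simpa using hexagon_pos []

theorem rootC_mul_rootC : rootC * rootC = 1 := comm_mul_self []

theorem shift_rootC_mul_self (b : Bool) : shift b rootC * shift b rootC = 1 := by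
  rw [← map_mul, rootC_mul_rootC, map_one]

/-- The hexagon relation says that `AC` is the product `st` of `s = C₁` and `t = A C₀ A⁻¹`. As
`C` exchanges `C₀` and `C₁`, the involutions `s` and `t` satisfy the braid relation, whence
`(st)³ = 1`. -/
theorem rootA_rootC_cube : rootA * rootC * (rootA * rootC) * (rootA * rootC) = 1 := by
  set s := shift true rootC with hs
  set t := rootA * shift false rootC * rootA⁻¹ with ht
  have hss : s * s = 1 := shift_rootC_mul_self true
  have htt : t * t = 1 := by
    rw [ht, show rootA * shift false rootC * rootA⁻¹ * (rootA * shift false rootC * rootA⁻¹) =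
      rootA * (shift false rootC * shift false rootC) * rootA⁻¹ by group, shift_rootC_mul_self]
    group
  have hst : rootA * rootC = s * t := by
    rw [ht, ← mul_assoc, ← mul_assoc, ← rootA_rootC_rootA, mul_inv_cancel_right]
  have hbraid : t * (s * t) = s * t * s := by
    rw [← hst, ht, hs, mul_assoc rootA rootC, ← shift_left_mul_rootC]
    group
  calc rootA * rootC * (rootA * rootC) * (rootA * rootC) = s * (t * (s * t)) * (s * t) := by
        rw [hst]; group
    _ = s * s * t * (s * s) * t := by rw [hbraid]; group
    _ = 1 := by rw [hss, mul_one, one_mul, htt]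

/-! ### Merging two sorted combs -/

/-- For disjoint nonempty finite sets `S` and `T` of labels, the element of the presented group
that turns the tree whose left (resp. right) subtree is the right comb with leaves `S` (resp. `T`)
in increasing order into the right comb with leaves `S ∪ T` in increasing order. It is `1` if `S`
or `T` is empty. -/
def merge (S T : Finset ℕ+) : ACGroup :=
  if h : S.Nonempty ∧ T.Nonempty then
    if S.min' h.1 < T.min' h.2 then
      if S.erase (S.min' h.1) = ∅ then 1
      else rootA⁻¹ * shift true (merge (S.erase (S.min' h.1)) T)
    else rootC *
      if T.erase (T.min' h.2) = ∅ then 1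
      else rootA⁻¹ * shift true (merge (T.erase (T.min' h.2)) S)
  else 1
termination_by S.card + T.card
decreasing_by
  · have := Finset.card_erase_lt_of_mem (S.min'_mem h.1); omega
  · have := Finset.card_erase_lt_of_mem (T.min'_mem h.2); omega

theorem min'_eq_of_forall_lt {x : ℕ+} {S : Finset ℕ+} (h : ∀ y ∈ S, x < y)
    (hne : (insert x S).Nonempty) : (insert x S).min' hne = x :=
  le_antisymm (Finset.min'_le _ _ (Finset.mem_insert_self x S)) <|
    Finset.le_min' _ _ _ fun y hy => by
      rcases Finset.mem_insert.1 hy with rfl | hy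
      exacts [le_rfl, (h y hy).le]

theorem merge_singleton {x : ℕ+} {T : Finset ℕ+} (hT : T.Nonempty) (h : ∀ y ∈ T, x < y) :
    merge {x} T = 1 := by
  rw [merge, dif_pos ⟨Finset.singleton_nonempty x, hT⟩]
  simp [h _ (T.min'_mem hT)]

theorem merge_insert {x : ℕ+} {S T : Finset ℕ+} (hS : S.Nonempty) (hT : T.Nonempty)
    (hxS : ∀ y ∈ S, x < y) (hxT : ∀ y ∈ T, x < y) :
    merge (insert x S) T = rootA⁻¹ * shift true (merge S T) := by
  have hx : x ∉ S := fun hx => lt_irrefl x (hxS x hx)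
  rw [merge, dif_pos ⟨Finset.insert_nonempty x S, hT⟩]
  simp only [min'_eq_of_forall_lt hxS]
  rw [if_pos (hxT _ (T.min'_mem hT)), Finset.erase_insert hx, if_neg hS.ne_empty]

theorem merge_comm {S T : Finset ℕ+} (hS : S.Nonempty) (hT : T.Nonempty) (h : Disjoint S T) :
    merge S T = rootC * merge T S := by
  wlog hlt : S.min' hS < T.min' hT generalizing S T
  · have hne : S.min' hS ≠ T.min' hT := fun e =>
      Finset.disjoint_left.1 h (S.min'_mem hS) (e ▸ T.min'_mem hT)
    rw [this hT hS h.symm (lt_of_le_of_ne (not_lt.1 hlt) hne.symm), ← mul_assoc,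
      rootC_mul_rootC, one_mul]
  · conv_lhs => rw [merge, dif_pos ⟨hS, hT⟩, if_pos hlt]
    conv_rhs => rw [merge, dif_pos ⟨hT, hS⟩, if_neg hlt.not_gt]
    rw [← mul_assoc, rootC_mul_rootC, one_mul]

/-- The two ways of merging three combs agree. -/
def MergeAssoc (S T U : Finset ℕ+) : Prop :=
  shift true (merge T U) * merge S (T ∪ U) = rootA * shift false (merge S T) * merge (S ∪ T) U

/-- When the smallest label is in the first comb, it is split off by means of the pentagon
relation. -/
theorem mergeAssoc_insert {x : ℕ+} {S T U : Finset ℕ+} (hT : T.Nonempty)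
    (hU : U.Nonempty) (hxS : ∀ y ∈ S, x < y) (hxT : ∀ y ∈ T, x < y) (hxU : ∀ y ∈ U, x < y)
    (ih : S.Nonempty → MergeAssoc S T U) : MergeAssoc (insert x S) T U := by
  have hxTU : ∀ y ∈ T ∪ U, x < y := fun y hy => (Finset.mem_union.1 hy).elim (hxT y) (hxU y)
  rw [MergeAssoc]
  rcases S.eq_empty_or_nonempty with rfl | hS
  · rw [insert_empty_eq, merge_singleton (hT.mono Finset.subset_union_left) hxTU,
      merge_singleton hT hxT, ← Finset.insert_eq, merge_insert hT hU hxT hxU]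
    simp
  · have hxST : ∀ y ∈ S ∪ T, x < y := fun y hy => (Finset.mem_union.1 hy).elim (hxS y) (hxT y)
    rw [merge_insert hS (hT.mono Finset.subset_union_left) hxS hxTU,
      merge_insert hS hT hxS hxT, Finset.insert_union,
      merge_insert (hS.mono Finset.subset_union_left) hU hxST hxU]
    have e₁ : rootA * (shift false rootA)⁻¹ = rootA⁻¹ * shift true rootA * rootA := by
      rw [mul_inv_eq_iff_eq_mul, mul_assoc, mul_assoc, eq_inv_mul_iff_mul_eq, rootA_mul_rootA,
        mul_assoc]
    have e₂ := shift_middle_mul_rootA (merge S T)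
    have e₃ := shift_right_mul_rootA (merge T U)
    have e₄ := congrArg (shift true) (ih hS)
    simp only [map_mul, map_inv] at e₄ ⊢
    calc shift true (merge T U) * (rootA⁻¹ * shift true (merge S (T ∪ U)))
        = rootA⁻¹ * (shift true (shift true (merge T U)) * shift true (merge S (T ∪ U))) := by
          rw [← mul_assoc, ← mul_assoc]
          congr 1
          rw [mul_inv_eq_iff_eq_mul, mul_assoc, e₃, inv_mul_cancel_left]
      _ = rootA⁻¹ * shift true rootA * (rootA * shift false (shift true (merge S T)) * rootA⁻¹) *
            shift true (merge (S ∪ T) U) := by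
          rw [e₄, ← e₂]; group
      _ = rootA * (shift false rootA)⁻¹ * shift false (shift true (merge S T)) * rootA⁻¹ *
            shift true (merge (S ∪ T) U) := by
          rw [e₁]; group
      _ = _ := by group

/-- By the hexagon relation, associativity of merging for `S, T, U` follows from the cases where
`T` comes first. -/
theorem MergeAssoc.of_middle {S T U : Finset ℕ+} (hS : S.Nonempty) (hT : T.Nonempty)
    (hU : U.Nonempty) (hST : Disjoint S T) (hSU : Disjoint S U)
    (h₁ : MergeAssoc T S U) (h₂ : MergeAssoc T U S) : MergeAssoc S T U := by
  rw [MergeAssoc] at *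
  have hTU' : (T ∪ U).Nonempty := hT.mono Finset.subset_union_left
  have hd : Disjoint (T ∪ U) S := Finset.disjoint_union_left.2 ⟨hST.symm, hSU.symm⟩
  rw [merge_comm hS hU hSU, Finset.union_comm S U, map_mul, mul_assoc, h₂,
    merge_comm hTU' hS hd, merge_comm hT hS hST.symm, map_mul, Finset.union_comm T S] at h₁
  have h₃ : shift true rootC * rootA * rootC * (shift true (merge T U) * merge S (T ∪ U)) =
      rootA * shift false rootC * shift false (merge S T) * merge (S ∪ T) U := by
    rw [← mul_assoc rootA] at h₁
    rw [← h₁]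
    have := shift_left_mul_rootC (merge T U)
    simp only [mul_assoc] at this ⊢
    rw [← mul_assoc rootC (shift true _), ← this]
    simp only [mul_assoc]
  have h₄ : rootA * shift false rootC = shift true rootC * rootA * rootC * rootA := by
    have := rootA_rootC_rootA
    have h := shift_rootC_mul_self true
    rw [mul_assoc, mul_assoc, ← mul_assoc rootA, this, ← mul_assoc, ← mul_assoc, h, one_mul]
  rw [h₄] at h₃
  apply mul_left_cancel (a := shift true rootC * rootA * rootC)
  rw [h₃]
  group

/-- By the relation `(AC)³ = 1`, associativity of merging for `S, T, U` follows from the case of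
`U, T, S`. -/
theorem MergeAssoc.of_last {S T U : Finset ℕ+} (hS : S.Nonempty) (hT : T.Nonempty)
    (hU : U.Nonempty) (hST : Disjoint S T) (hSU : Disjoint S U) (hTU : Disjoint T U)
    (h : MergeAssoc U T S) : MergeAssoc S T U := by
  rw [MergeAssoc] at *
  have hTU' : (T ∪ U).Nonempty := hT.mono Finset.subset_union_left
  have hST' : (S ∪ T).Nonempty := hS.mono Finset.subset_union_left
  have hd : Disjoint (T ∪ U) S := Finset.disjoint_union_left.2 ⟨hST.symm, hSU.symm⟩
  have hd' : Disjoint U (S ∪ T) := Finset.disjoint_union_right.2 ⟨hSU.symm, hTU.symm⟩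
  rw [merge_comm hT hS hST.symm, Finset.union_comm T S, merge_comm hU hST' hd',
    Finset.union_comm U T, merge_comm hTU' hS hd, merge_comm hU hT hTU.symm] at h
  set m₁ := merge S T
  set m₂ := merge T U
  set m₃ := merge (S ∪ T) U
  set m₄ := merge S (T ∪ U)
  -- `(ACA) C (AC) = 1`, where `ACA` is rewritten as `C₁ A C₀`.
  have h₁ : shift true rootC * rootA * shift false rootC * rootC * rootA * rootC = 1 := by
    rw [← rootA_rootC_rootA, ← rootA_rootC_cube]; group
  have h₂ : shift true (rootC * m₁) * (rootC * m₃) =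
      shift true rootC * rootC * (shift false m₁ * m₃) := by
    rw [map_mul, mul_assoc, ← mul_assoc (shift true m₁), shift_right_mul_rootC]; group
  have h₃ : rootA * shift false (rootC * m₂) * (rootC * m₄) =
      rootA * shift false rootC * rootC * (shift true m₂ * m₄) := by
    rw [map_mul]
    have := shift_left_mul_rootC m₂
    simp only [mul_assoc] at this ⊢
    rw [← mul_assoc _ rootC m₄, this]
    simp only [mul_assoc]
  rw [h₂, h₃] at h
  have hC : rootC⁻¹ = rootC := inv_eq_of_mul_eq_one_left rootC_mul_rootC
  have hC' : (shift true rootC)⁻¹ = shift true rootC :=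
    inv_eq_of_mul_eq_one_left (shift_rootC_mul_self true)
  have h₄ : rootA * shift false rootC * rootC * rootA = shift true rootC * rootC := by
    calc rootA * shift false rootC * rootC * rootA
        = (shift true rootC)⁻¹ *
            (shift true rootC * rootA * shift false rootC * rootC * rootA * rootC) * rootC⁻¹ := by
          group
      _ = _ := by rw [h₁, hC, hC', mul_one]
  rw [← h₄, mul_assoc _ rootA, mul_right_inj] at h
  rw [← h, mul_assoc]

/-- Merging three combs with pairwise disjoint sets of leaves is associative. -/
theorem mergeAssoc {S T U : Finset ℕ+} (hS : S.Nonempty) (hT : T.Nonempty) (hU : U.Nonempty)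
    (hST : Disjoint S T) (hSU : Disjoint S U) (hTU : Disjoint T U) : MergeAssoc S T U := by
  induction hn : S.card + T.card + U.card using Nat.strong_induction_on generalizing S T U with
  | _ n ih =>
    subst hn
    -- The case of the smallest label lying in the first comb, for any three combs of the same
    -- total size.
    have first : ∀ {S' T' U' : Finset ℕ+} (hS' : S'.Nonempty), T'.Nonempty → U'.Nonempty →
        Disjoint S' T' → Disjoint S' U' → Disjoint T' U' →
        S'.card + T'.card + U'.card = S.card + T.card + U.card →
        (∀ y ∈ T', S'.min' hS' < y) → (∀ y ∈ U', S'.min' hS' < y) → MergeAssoc S' T' U' := by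
      intro S' T' U' hS' hT' hU' h₁ h₂ h₃ hcard hxT hxU
      have hmem := S'.min'_mem hS'
      have hlt := Finset.card_erase_lt_of_mem hmem
      rw [← Finset.insert_erase hmem]
      refine mergeAssoc_insert hT' hU' (fun y hy => ?_) hxT hxU fun hne => ?_
      · exact lt_of_le_of_ne (S'.min'_le y (Finset.mem_of_mem_erase hy))
          (Finset.ne_of_mem_erase hy).symm
      · exact ih _ (by omega) hne hT' hU' (h₁.mono_left (Finset.erase_subset _ _))
          (h₂.mono_left (Finset.erase_subset _ _)) h₃ rfl
    have lt_of {S' T' : Finset ℕ+} {hS' : S'.Nonempty} {hT' : T'.Nonempty}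
        (h : S'.min' hS' < T'.min' hT') : ∀ y ∈ T', S'.min' hS' < y :=
      fun y hy => h.trans_le (T'.min'_le y hy)
    have ne {S' T' : Finset ℕ+} (hS' : S'.Nonempty) (hT' : T'.Nonempty) (h : Disjoint S' T') :
        S'.min' hS' ≠ T'.min' hT' := fun e =>
      Finset.disjoint_left.1 h (S'.min'_mem hS') (e ▸ T'.min'_mem hT')
    rcases lt_or_gt_of_ne (ne hS hT hST) with h₁ | h₁
    · rcases lt_or_gt_of_ne (ne hS hU hSU) with h₂ | h₂
      · exact first hS hT hU hST hSU hTU rfl (lt_of h₁) (lt_of h₂)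
      · exact .of_last hS hT hU hST hSU hTU <| first hU hT hS hTU.symm hSU.symm hST.symm
          (by omega) (lt_of (h₂.trans h₁)) (lt_of h₂)
    · rcases lt_or_gt_of_ne (ne hT hU hTU) with h₂ | h₂
      · exact .of_middle hS hT hU hST hSU
          (first hT hS hU hST.symm hTU hSU (by omega) (lt_of h₁) (lt_of h₂))
          (first hT hU hS hTU hST.symm hSU.symm (by omega) (lt_of h₂) (lt_of h₁))
      · exact .of_last hS hT hU hST hSU hTU <| first hU hT hS hTU.symm hSU.symm hST.symm
          (by omega) (lt_of h₂) (lt_of (h₂.trans h₁))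

end ACGroup

/-! ### Leaves, and evaluation of operators -/

namespace CTree

/-- The multiset of the labels of the leaves. -/
def leaves : CTree → Multiset ℕ+
  | .of i => {i}
  | .mul a b => leaves a + leaves b

theorem leaves_mul (a b : CTree) : leaves (.mul a b) = leaves a + leaves b := rfl

theorem leaves_of (i : ℕ+) : leaves (.of i) = {i} := rfl

theorem toFinset_leaves_nonempty (t : CTree) : t.leaves.toFinset.Nonempty := by
  induction t with
  | of i => exact ⟨i, by simp [leaves_of]⟩
  | mul a b ha _ =>
    obtain ⟨i, hi⟩ := ha
    exact ⟨i, by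
      rw [Multiset.mem_toFinset] at hi ⊢
      exact Multiset.mem_add.2 (Or.inl hi)⟩

theorem nodup_leaves_mul {a b : CTree} : (leaves (.mul a b)).Nodup ↔
    (leaves a).Nodup ∧ (leaves b).Nodup ∧ Disjoint a.leaves.toFinset b.leaves.toFinset := by
  rw [leaves_mul, Multiset.nodup_add, Multiset.disjoint_toFinset]

@[simp] theorem mul_apply (f g : CTree ≃. CTree) (t : CTree) : (f * g) t = (f t).bind g := rfl

@[simp] theorem one_apply (t : CTree) : (1 : CTree ≃. CTree) t = some t := rfl

@[simp] theorem onLeft_mul (f : CTree ≃. CTree) (a b : CTree) :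
    onLeft f (a * b) = (f a).map fun s => s * b := rfl

@[simp] theorem onRight_mul (f : CTree ≃. CTree) (a b : CTree) :
    onRight f (a * b) = (f b).map fun s => a * s := rfl

@[simp] theorem comm_mul (a b : CTree) : comm (a * b) = some (b * a) := rfl

@[simp] theorem assoc_mul_of (a : CTree) (i : ℕ+) : assoc (a * .of i) = none := rfl

@[simp] theorem assoc_mul_mul (a b c : CTree) :
    assoc (a * (b * c)) = some (a * b * c) := rfl

theorem assoc_eq_some {t t' : CTree} (h : assoc t = some t') :
    ∃ a b c, t = .mul a (.mul b c) ∧ t' = .mul (.mul a b) c := by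
  rcases t with i | ⟨a, (i | ⟨b, c⟩)⟩
  · cases h
  · cases h
  · cases h; exact ⟨a, b, c, rfl, rfl⟩

theorem comm_eq_some {t t' : CTree} (h : comm t = some t') :
    ∃ a b, t = .mul a b ∧ t' = .mul b a := by
  rcases t with i | ⟨a, b⟩
  · cases h
  · cases h; exact ⟨a, b, rfl, rfl⟩

theorem onLeft_eq_some {f : CTree ≃. CTree} {t t' : CTree} (h : onLeft f t = some t') :
    ∃ a a' b, f a = some a' ∧ t = .mul a b ∧ t' = .mul a' b := by
  rcases t with i | ⟨a, b⟩
  · cases h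
  · obtain ⟨a', ha', rfl⟩ := Option.map_eq_some_iff.1 h
    exact ⟨a, a', b, ha', rfl, rfl⟩

theorem onRight_eq_some {f : CTree ≃. CTree} {t t' : CTree} (h : onRight f t = some t') :
    ∃ a b b', f b = some b' ∧ t = .mul a b ∧ t' = .mul a b' := by
  rcases t with i | ⟨a, b⟩
  · cases h
  · obtain ⟨b', hb', rfl⟩ := Option.map_eq_some_iff.1 h
    exact ⟨a, b, b', hb', rfl, rfl⟩

/-- An equivalence relation between trees that is respected by all `A_α` and `C_α` is respected by
the geometry monoid. -/
theorem rel_of_mem_geometryMonoid {P : CTree → CTree → Prop} (hP : Equivalence P)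
    (h : ∀ X α t t', lawOp X α t = some t' → P t t') {g : CTree ≃. CTree}
    (hg : g ∈ GeometryMonoid) : ∀ t t', g t = some t' → P t t' := by
  induction hg using Submonoid.closure_induction with
  | mem f hf =>
    obtain ⟨X, α, rfl | rfl⟩ := hf
    · exact h X α
    · exact fun t t' ht => hP.symm (h X α t' t (PEquiv.eq_some_iff _ |>.1 ht))
  | one => rintro t _ ⟨⟩; exact hP.refl t
  | mul f g _ _ hf hg =>
    intro t t' ht
    obtain ⟨s, hs, ht⟩ := mul_eq_some.1 ht
    exact hP.trans (hf t s hs) (hg s t' ht)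

theorem leaves_eq_of_lawOp {X : Law} {α : Address} {t t' : CTree} (h : lawOp X α t = some t') :
    leaves t = leaves t' := by
  induction α generalizing t t' with
  | nil =>
    cases X
    · obtain ⟨a, b, c, rfl, rfl⟩ := assoc_eq_some h
      exact (add_assoc _ _ _).symm
    · obtain ⟨a, b, rfl, rfl⟩ := comm_eq_some h
      exact add_comm _ _
  | cons b α ih =>
    cases b
    · obtain ⟨a, a', b, ha, rfl, rfl⟩ := onLeft_eq_some h
      rw [leaves_mul, leaves_mul, ih ha]
    · obtain ⟨a, b, b', hb, rfl, rfl⟩ := onRight_eq_some h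
      rw [leaves_mul, leaves_mul, ih hb]

theorem leaves_eq_of_mem {g : CTree ≃. CTree} (hg : g ∈ GeometryMonoid) {t t' : CTree}
    (h : g t = some t') : leaves t = leaves t' :=
  rel_of_mem_geometryMonoid (P := fun t t' => leaves t = leaves t')
    ⟨fun _ => rfl, Eq.symm, Eq.trans⟩ (fun _ _ _ _ => leaves_eq_of_lawOp) hg t t' h

/-- There are full trees of any depth with pairwise distinct labels, all at least `k`. The
last clause says that every path of length `n` leads to a leaf. -/
theorem exists_full_nodup (n : ℕ) (k : ℕ+) : ∃ t : CTree, (leaves t).Nodup ∧ minDepth t = n ∧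
    (∀ i ∈ leaves t, k ≤ i) ∧
    ∀ u : List Bool, u.length = n → ∃ i, ∀ x, t.locate (Stream'.appendStream' u x) = (i, x) := by
  induction n generalizing k with
  | zero =>
    refine ⟨.of k, Multiset.nodup_singleton k, rfl, fun i hi => ?_, fun u hu => ⟨k, fun x => ?_⟩⟩
    · rw [Multiset.mem_singleton.1 hi]
    · rw [List.eq_nil_of_length_eq_zero hu]; rfl
  | succ n ih =>
    obtain ⟨a, ha, hda, hka, hla⟩ := ih k
    set m := a.leaves.toFinset.max' (toFinset_leaves_nonempty a)
    have hm : ∀ i ∈ leaves a, i ≤ m := fun i hi =>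
      Finset.le_max' _ _ (Multiset.mem_toFinset.2 hi)
    have hkm : k ≤ m := hka _ (Multiset.mem_toFinset.1 (Finset.max'_mem _ _))
    obtain ⟨b, hb, hdb, hkb, hlb⟩ := ih (m + 1)
    refine ⟨.mul a b, nodup_leaves_mul.2 ⟨ha, hb, ?_⟩, ?_, fun i hi => ?_, fun u hu => ?_⟩
    · refine Finset.disjoint_left.2 fun i hi hi' => ?_
      rw [Multiset.mem_toFinset] at hi hi'
      exact absurd (hkb i hi') (not_le.2 ((hm i hi).trans_lt (PNat.lt_add_right m 1)))
    · rw [minDepth, hda, hdb, min_self]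
    · rcases Multiset.mem_add.1 hi with hi | hi
      · exact hka i hi
      · exact hkm.trans ((PNat.lt_add_right m 1).le.trans (hkb i hi))
    · rcases u with _ | ⟨_ | _, u⟩
      · simp at hu
      · exact hla u (by simpa using hu)
      · exact hlb u (by simpa using hu)

/-! ### The relations hold between the operators -/

theorem shift_append (f : CTree ≃. CTree) (γ δ : Address) :
    shift f (γ ++ δ) = shift (shift f δ) γ := by
  induction γ with
  | nil => rfl
  | cons b γ ih => cases b <;> simp [shift, ih]

theorem onLeft_mul_onLeft (f g : CTree ≃. CTree) : onLeft f * onLeft g = onLeft (f * g) := by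
  refine PEquiv.ext ?_
  rintro (i | ⟨a, b⟩)
  · rfl
  · cases h : f a <;> simp [h]

theorem onRight_mul_onRight (f g : CTree ≃. CTree) : onRight f * onRight g = onRight (f * g) := by
  refine PEquiv.ext ?_
  rintro (i | ⟨a, b⟩)
  · rfl
  · cases h : f b <;> simp [h]

theorem shift_mul_shift (f g : CTree ≃. CTree) (γ : Address) :
    shift f γ * shift g γ = shift (f * g) γ := by
  induction γ with
  | nil => rfl
  | cons b γ ih => cases b <;> simp [shift, onLeft_mul_onLeft, onRight_mul_onRight, ih]

theorem onLeft_mul_onRight (f g : CTree ≃. CTree) :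
    onLeft f * onRight g = onRight g * onLeft f := by
  refine PEquiv.ext ?_
  rintro (i | ⟨a, b⟩)
  · rfl
  · cases h : f a <;> cases h' : g b <;> simp [h, h']

theorem onRight_onRight_mul_assoc (f : CTree ≃. CTree) :
    onRight (onRight f) * assoc = assoc * onRight f := by
  refine PEquiv.ext ?_
  rintro (i | ⟨a, i | ⟨b, c⟩⟩)
  · rfl
  · rfl
  · cases h : f c <;> simp [h]

theorem onRight_onLeft_mul_assoc (f : CTree ≃. CTree) :
    onRight (onLeft f) * assoc = assoc * onLeft (onRight f) := by
  refine PEquiv.ext ?_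
  rintro (i | ⟨a, i | ⟨b, c⟩⟩)
  · rfl
  · rfl
  · cases h : f b <;> simp [h]

theorem onLeft_mul_assoc (f : CTree ≃. CTree) :
    onLeft f * assoc = assoc * onLeft (onLeft f) := by
  refine PEquiv.ext ?_
  rintro (i | ⟨a, i | ⟨b, c⟩⟩)
  · rfl
  · cases h : f a <;> simp [h]
  · cases h : f a <;> simp [h]

theorem onLeft_mul_comm (f : CTree ≃. CTree) : onLeft f * comm = comm * onRight f := by
  refine PEquiv.ext ?_
  rintro (i | ⟨a, b⟩)
  · rfl
  · cases h : f a <;> simp [h]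

theorem onRight_mul_comm (f : CTree ≃. CTree) : onRight f * comm = comm * onLeft f := by
  refine PEquiv.ext ?_
  rintro (i | ⟨a, b⟩)
  · rfl
  · cases h : f b <;> simp [h]

theorem assoc_mul_assoc : assoc * assoc = onRight assoc * assoc * onLeft assoc := by
  refine PEquiv.ext ?_
  rintro (i | ⟨a, i | ⟨b, i | ⟨c, d⟩⟩⟩) <;> rfl

theorem assoc_comm_assoc : assoc * comm * assoc = onRight comm * assoc * onLeft comm := by
  refine PEquiv.ext ?_
  rintro (i | ⟨a, i | ⟨b, c⟩⟩) <;> rfl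

theorem assoc_symm_comm_assoc_symm :
    assoc.symm * comm * assoc.symm = onLeft comm * assoc.symm * onRight comm := by
  refine PEquiv.ext ?_
  rintro (i | ⟨i | ⟨a, b⟩, c⟩) <;> rfl

theorem eq_of_comm_mul_comm {t t' : CTree} (α : Address)
    (h : shift (comm * comm) α t = some t') : t = t' := by
  induction α generalizing t t' with
  | nil =>
    obtain ⟨s, hs, h⟩ := mul_eq_some.1 h
    obtain ⟨a, b, rfl, rfl⟩ := comm_eq_some hs
    cases h
    rfl
  | cons b α ih =>
    cases b
    · obtain ⟨a, a', b, ha, rfl, rfl⟩ := onLeft_eq_some h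
      rw [ih ha]
    · obtain ⟨a, b, b', hb, rfl, rfl⟩ := onRight_eq_some h
      rw [ih hb]

end CTree

/-! ### The homomorphism from the presented group to the geometry group -/

namespace GeometryGroup

/-- The operator `X_α`, as an element of the geometry monoid. -/
def genOp (X : Law) (α : Address) : GeometryMonoid :=
  ⟨lawOp X α, Submonoid.subset_closure ⟨X, α, Or.inl rfl⟩⟩

/-- The inverse of a partial injection, in the geometry monoid. -/
def symmOp (g : GeometryMonoid) : GeometryMonoid :=
  ⟨(g : CTree ≃. CTree).symm, symm_mem_geometryMonoid g.2⟩

theorem mk_mul (g h : GeometryMonoid) : mk (g * h) = mk g * mk h := rfl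

theorem mk_one : mk 1 = 1 := rfl

theorem mk_symmOp (g : GeometryMonoid) : mk (symmOp g) = (mk g)⁻¹ :=
  eq_inv_of_mul_eq_one_left ((Con.eq nearEqCon).2 (nearEq_symm_mul g.2))

theorem mk_eq_mk {g h : GeometryMonoid} : mk g = mk h ↔ NearEq g h := Con.eq nearEqCon

theorem exists_mk (a : GeometryGroup) : ∃ g, mk g = a := Con.mk'_surjective a

theorem gen_eq (X : Law) (α : Address) : gen X α = mk (genOp X α) := rfl

theorem mk_congr {g h : GeometryMonoid} (e : (g : CTree ≃. CTree) = h) : mk g = mk h :=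
  congrArg mk (Subtype.ext e)

open CTree

theorem lift_gen_geometricRel (u v : FreeGroup (Law × Address)) (h : GeometricRel u v) :
    FreeGroup.lift (fun p => gen p.1 p.2) u = FreeGroup.lift (fun p => gen p.1 p.2) v := by
  cases h <;> simp only [map_mul, letter, FreeGroup.lift_apply_of, gen_eq, ← mk_mul] <;>
    apply mk_congr <;>
    simp only [genOp, Submonoid.coe_mul, lawOp, shift_append, shift_mul_shift, shift, Law.operator]
  · rw [onLeft_mul_onRight]
  · rw [onRight_onRight_mul_assoc]
  · rw [onRight_onLeft_mul_assoc]
  · rw [onLeft_mul_assoc]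
  · rw [onLeft_mul_comm]
  · rw [onRight_mul_comm]

theorem lift_gen_pentagonRel (u v : FreeGroup (Law × Address)) (h : PentagonRel u v) :
    FreeGroup.lift (fun p => gen p.1 p.2) u = FreeGroup.lift (fun p => gen p.1 p.2) v := by
  cases h
  simp only [map_mul, letter, FreeGroup.lift_apply_of, gen_eq, ← mk_mul]
  apply mk_congr
  simp only [genOp, Submonoid.coe_mul, lawOp, shift_append, shift_mul_shift, shift, Law.operator]
  rw [assoc_mul_assoc]

theorem lift_gen_hexagonRel (u v : FreeGroup (Law × Address)) (h : HexagonRel u v) :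
    FreeGroup.lift (fun p => gen p.1 p.2) u = FreeGroup.lift (fun p => gen p.1 p.2) v := by
  cases h <;>
    simp only [map_mul, map_inv, letter, FreeGroup.lift_apply_of, gen_eq, ← mk_symmOp, ← mk_mul] <;>
    apply mk_congr <;>
    simp only [genOp, symmOp, Submonoid.coe_mul, lawOp, shift_append, CTree.shift_symm,
      shift_mul_shift, shift, Law.operator]
  · rw [assoc_comm_assoc]
  · rw [assoc_symm_comm_assoc_symm]

theorem gen_comm_mul_self (α : Address) : gen .C α * gen .C α = 1 := by
  rw [gen_eq, ← mk_mul, ← mk_one, mk_eq_mk]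
  refine ⟨exists_common (genOp .C α * genOp .C α).2 (one_mem _), fun t ht _ => ?_⟩
  obtain ⟨u, hu⟩ := Option.isSome_iff_exists.1 ht
  rw [hu]
  change (shift comm α * shift comm α) t = some u at hu
  rw [shift_mul_shift] at hu
  rw [eq_of_comm_mul_comm α hu]
  rfl

end GeometryGroup

namespace ACGroup

open CTree GeometryGroup

/-- The homomorphism from the presented group to the geometry group mapping each generator to the
element with the same name. -/
noncomputable def toGeometryGroup : ACGroup →* GeometryGroup :=
  PresentedGroup.toGroup (f := fun p => gen p.1 p.2) <|
    lift_relator_eq_one lift_gen_geometricRel lift_gen_pentagonRel lift_gen_hexagonRel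
      gen_comm_mul_self

theorem toGeometryGroup_of (X : Law) (α : Address) : toGeometryGroup (of X α) = gen X α :=
  PresentedGroup.toGroup.of _

theorem toGeometryGroup_surjective : Function.Surjective toGeometryGroup := by
  intro a
  obtain ⟨⟨g, hg⟩, rfl⟩ := exists_mk a
  induction hg using Submonoid.closure_induction with
  | mem f hf =>
    obtain ⟨X, α, rfl | rfl⟩ := hf
    · exact ⟨of X α, toGeometryGroup_of X α⟩
    · refine ⟨(of X α)⁻¹, ?_⟩
      rw [map_inv, toGeometryGroup_of, gen_eq, ← mk_symmOp]
      rfl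
  | one => exact ⟨1, map_one _⟩
  | mul f g hf hg ihf ihg =>
    obtain ⟨u, hu⟩ := ihf
    obtain ⟨v, hv⟩ := ihg
    exact ⟨u * v, by rw [map_mul, hu, hv]; rfl⟩

/-! ### Normalizing trees in the presented group -/

/-- The element of the presented group that describes a path from the tree `t` to the right comb
with the same leaves in increasing order: both subtrees are normalized, and the resulting combs are
merged. -/
noncomputable def normalizer : CTree → ACGroup
  | .of _ => 1
  | .mul a b => shift false (normalizer a) * shift true (normalizer b) *
      merge (leaves a).toFinset (leaves b).toFinset

theorem normalizer_mul (a b : CTree) : normalizer (.mul a b) =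
    shift false (normalizer a) * shift true (normalizer b) *
      merge (leaves a).toFinset (leaves b).toFinset := rfl

/-- Coherence: normalizing before or after the action of a generator gives the same result. -/
theorem normalizer_lawOp {X : Law} {α : Address} {t t' : CTree} (h : lawOp X α t = some t')
    (ht : (leaves t).Nodup) : normalizer t = of X α * normalizer t' := by
  induction α generalizing t t' with
  | nil =>
    cases X
    · obtain ⟨a, b, c, rfl, rfl⟩ := assoc_eq_some h
      obtain ⟨-, hbc, habc⟩ := nodup_leaves_mul.1 ht
      obtain ⟨-, -, hbc⟩ := nodup_leaves_mul.1 hbc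
      rw [leaves_mul, Multiset.toFinset_add, Finset.disjoint_union_right] at habc
      have key := mergeAssoc (toFinset_leaves_nonempty a) (toFinset_leaves_nonempty b)
        (toFinset_leaves_nonempty c) habc.1 habc.2 hbc
      rw [MergeAssoc] at key
      simp only [normalizer_mul, leaves_mul, Multiset.toFinset_add, map_mul]
      generalize merge (leaves a).toFinset (leaves b).toFinset = p at *
      have h₁ := shift_left_mul_rootA (normalizer a)
      have h₂ := shift_middle_mul_rootA (normalizer b)
      have h₃ := shift_right_mul_rootA (normalizer c)
      have h₄ := shift_mul_shift p (normalizer c)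
      -- By `key`, a factor `A` appears before the last merging; it is moved to the front.
      simp only [mul_assoc] at key ⊢
      rw [key, ← mul_assoc (shift false p), h₄,
        ← mul_assoc rootA (shift false (shift false _)), ← h₁, mul_assoc (shift false _) rootA, ← mul_assoc rootA (shift false (shift true _)), ← h₂,
        mul_assoc (shift true _) rootA, mul_assoc (shift true _) (shift false p),
        ← mul_assoc rootA (shift true _), ← h₃, mul_assoc (shift true _) rootA]
    · obtain ⟨a, b, rfl, rfl⟩ := comm_eq_some h
      obtain ⟨-, -, hab⟩ := nodup_leaves_mul.1 ht
      rw [normalizer_mul, normalizer_mul,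
        merge_comm (toFinset_leaves_nonempty a) (toFinset_leaves_nonempty b) hab,
        ← mul_assoc, mul_assoc _ _ rootC, shift_right_mul_rootC, ← mul_assoc,
        shift_left_mul_rootC, mul_assoc rootC, ← shift_mul_shift, mul_assoc rootC]
  | cons d α ih =>
    cases d
    · obtain ⟨a, a', b, ha, rfl, rfl⟩ := onLeft_eq_some h
      rw [normalizer_mul, normalizer_mul, ih ha (nodup_leaves_mul.1 ht).1, leaves_eq_of_lawOp ha,
        map_mul, shift_of]
      simp only [mul_assoc]
    · obtain ⟨a, b, b', hb, rfl, rfl⟩ := onRight_eq_some h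
      rw [normalizer_mul, normalizer_mul, ih hb (nodup_leaves_mul.1 ht).2.1,
        leaves_eq_of_lawOp hb, map_mul, shift_of, ← mul_assoc (shift false _),
        ← shift_of true X α, shift_mul_shift]
      simp only [mul_assoc]

/-- Each element of the presented group is realized by an operator along which normalizers are
compatible. -/
theorem exists_operator (w : ACGroup) : ∃ g : GeometryMonoid, toGeometryGroup w = mk g ∧
    ∀ t t', (g : CTree ≃. CTree) t = some t' → (leaves t).Nodup →
      normalizer t = w * normalizer t' := by
  induction w using PresentedGroup.induction_on with
  | _ z =>
  induction z using FreeGroup.induction_on with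
  | C1 =>
    refine ⟨1, map_one _, ?_⟩
    rintro t _ ⟨⟩ -
    rw [map_one, one_mul]
  | of p => exact ⟨genOp p.1 p.2, toGeometryGroup_of p.1 p.2, fun t t' => normalizer_lawOp⟩
  | inv_of p _ =>
    refine ⟨symmOp (genOp p.1 p.2), ?_, fun t t' h ht => ?_⟩
    · rw [map_inv, map_inv, mk_symmOp]
      exact congrArg _ (toGeometryGroup_of p.1 p.2)
    · rw [leaves_eq_of_mem (symmOp (genOp p.1 p.2)).2 h] at ht
      rw [map_inv, eq_inv_mul_iff_mul_eq]
      exact (normalizer_lawOp (PEquiv.eq_some_iff _ |>.1 h) ht).symm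
  | mul x y hx hy =>
    obtain ⟨f, hf, hf'⟩ := hx
    obtain ⟨g, hg, hg'⟩ := hy
    refine ⟨f * g, by rw [map_mul, map_mul, hf, hg, mk_mul], fun t t' h ht => ?_⟩
    obtain ⟨s, hs, h⟩ := mul_eq_some.1 h
    rw [hf' t s hs ht, hg' s t' h (leaves_eq_of_mem f.2 hs ▸ ht), map_mul, mul_assoc]

theorem toGeometryGroup_injective : Function.Injective toGeometryGroup := by
  rw [injective_iff_map_eq_one]
  intro w hw
  obtain ⟨g, hg, h⟩ := exists_operator w
  rw [hw, ← mk_one, eq_comm, mk_eq_mk] at hg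
  obtain ⟨N, hN⟩ := deepDom_of_mem g.2
  obtain ⟨t, ht, hd, -⟩ := exists_full_nodup N 1
  obtain ⟨t', ht', -⟩ := hN 0 t hd.ge
  have e := hg.2 t (by simp [ht']) rfl
  exact mul_eq_right.1 (h t t (e.trans rfl) ht).symm

/-- The isomorphism between the presented group and the geometry group. -/
noncomputable def equivGeometryGroup : ACGroup ≃* GeometryGroup :=
  MulEquiv.ofBijective toGeometryGroup ⟨toGeometryGroup_injective, toGeometryGroup_surjective⟩

end ACGroup

/-! ### Dyadic partitions -/

namespace CTree

open scoped Stream'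

theorem exists_cons (x : Stream' Bool) : ∃ d y, x = Stream'.cons d y :=
  ⟨x.head, x.tail, (Stream'.eta x).symm⟩

theorem locate_fst_mem (t : CTree) (x : Stream' Bool) : (t.locate x).1 ∈ leaves t := by
  induction t generalizing x with
  | of i => exact Multiset.mem_singleton_self i
  | mul a b ha hb =>
    obtain ⟨_ | _, y, rfl⟩ := exists_cons x
    · exact Multiset.mem_add.2 (Or.inl (ha y))
    · exact Multiset.mem_add.2 (Or.inr (hb y))

theorem exists_locate_eq {t : CTree} {i : ℕ+} (hi : i ∈ leaves t) (y : Stream' Bool) :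
    ∃ x, t.locate x = (i, y) := by
  induction t with
  | of j => rw [leaves_of, Multiset.mem_singleton] at hi; exact ⟨y, by rw [hi]; rfl⟩
  | mul a b ha hb =>
    rcases Multiset.mem_add.1 hi with hi | hi
    · obtain ⟨x, hx⟩ := ha hi
      exact ⟨.cons false x, hx⟩
    · obtain ⟨x, hx⟩ := hb hi
      exact ⟨.cons true x, hx⟩

theorem locate_injective {t : CTree} (ht : (leaves t).Nodup) : Function.Injective t.locate := by
  induction t with
  | of i => intro x y h; exact (Prod.mk.inj h).2
  | mul a b ha hb =>
    obtain ⟨hna, hnb, hd⟩ := nodup_leaves_mul.1 ht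
    have hab (x y : Stream' Bool) : locate a x ≠ locate b y := fun h =>
      Finset.disjoint_left.1 hd (Multiset.mem_toFinset.2 (locate_fst_mem a x))
        (Multiset.mem_toFinset.2 (h ▸ locate_fst_mem b y))
    intro x y h
    obtain ⟨_ | _, x, rfl⟩ := exists_cons x <;> obtain ⟨_ | _, y, rfl⟩ := exists_cons y
    · exact congrArg _ (ha hna h)
    · exact absurd h (hab _ _)
    · exact absurd h.symm (hab _ _)
    · exact congrArg _ (hb hnb h)

theorem nodup_leaves_of_locate_injective {t : CTree} (h : Function.Injective t.locate) :
    (leaves t).Nodup := by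
  induction t with
  | of i => exact Multiset.nodup_singleton i
  | mul a b ha hb =>
    refine nodup_leaves_mul.2 ⟨ha fun x y hxy => ?_, hb fun x y hxy => ?_,
      Finset.disjoint_left.2 fun i hi hi' => ?_⟩
    · exact Stream'.cons_injective_right _ (h (a₁ := .cons false x) (a₂ := .cons false y) hxy)
    · exact Stream'.cons_injective_right _ (h (a₁ := .cons true x) (a₂ := .cons true y) hxy)
    · obtain ⟨x, hx⟩ := exists_locate_eq (Multiset.mem_toFinset.1 hi) (.const false)
      obtain ⟨y, hy⟩ := exists_locate_eq (Multiset.mem_toFinset.1 hi') (.const false)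
      have e := h (a₁ := .cons false x) (a₂ := .cons true y) (hx.trans hy.symm)
      exact absurd (congrArg Stream'.head e) Bool.false_ne_true

theorem eq_of_locate_eq {t t' : CTree} (h : ∀ x, t.locate x = t'.locate x) : t = t' := by
  -- Some path `0…` in `a * b` reaches a leaf with remaining sequence `111…`, whereas a one-leaf
  -- tree leaves each path unchanged.
  have key (i : ℕ+) (a b : CTree) : ¬ ∀ x, locate (.of i) x = locate (a * b) x := by
    intro h
    obtain ⟨j, hj⟩ := toFinset_leaves_nonempty a
    obtain ⟨x, hx⟩ := exists_locate_eq (Multiset.mem_toFinset.1 hj) (.const true)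
    have e := (h (.cons false x)).trans hx
    exact absurd (congrArg Stream'.head (Prod.mk.inj e).2) Bool.false_ne_true
  induction t generalizing t' with
  | of i =>
    rcases t' with j | ⟨a, b⟩
    · rw [(Prod.mk.inj (h (.const true))).1]
    · exact absurd h (key i a b)
  | mul a b ha hb =>
    rcases t' with j | ⟨c, d⟩
    · exact absurd (fun x => (h x).symm) (key j a b)
    · rw [ha fun x => h (.cons false x), hb fun x => h (.cons true x)]

/-- A map sending each sequence to a label and a remaining sequence is of the form `t.locate` if
each word of length `n` has a prefix that is stripped off by the map. -/
theorem exists_locate_eq_of_prefix (n : ℕ) (h : Stream' Bool → ℕ+ × Stream' Bool)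
    (hh : ∀ w : List Bool, w.length = n → ∃ w₁ w₂, w = w₁ ++ w₂ ∧ ∃ i, ∀ x, h (w₁ ++ₛ x) = (i, x)) :
    ∃ t : CTree, ∀ x, t.locate x = h x := by
  induction n generalizing h with
  | zero =>
    obtain ⟨w₁, w₂, hw, i, hi⟩ := hh [] rfl
    rw [(List.append_eq_nil_iff.1 hw.symm).1] at hi
    exact ⟨.of i, fun x => (hi x).symm⟩
  | succ n ih =>
    by_cases hleaf : ∃ i, ∀ x, h x = (i, x)
    · obtain ⟨i, hi⟩ := hleaf
      exact ⟨.of i, fun x => (hi x).symm⟩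
    · have step (d : Bool) : ∃ t : CTree, ∀ x, t.locate x = h (.cons d x) := by
        refine ih (fun x => h (.cons d x)) fun w hw => ?_
        obtain ⟨w₁, w₂, e, i, hi⟩ := hh (d :: w) (by simp [hw])
        rcases w₁ with _ | ⟨d', w₁⟩
        · exact absurd ⟨i, hi⟩ hleaf
        · obtain ⟨rfl, rfl⟩ := List.cons.inj e
          exact ⟨w₁, w₂, rfl, i, hi⟩
      obtain ⟨a, ha⟩ := step false
      obtain ⟨b, hb⟩ := step true
      refine ⟨a * b, fun x => ?_⟩
      obtain ⟨_ | _, y, rfl⟩ := exists_cons x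
      exacts [ha y, hb y]

/-! ### Trees with the same leaves are connected by the geometry monoid -/

/-- An operator acts on left subtrees through some element of the geometry monoid, found letter by
letter; `onLeft` does not preserve `1`, so that it cannot be applied to products directly. -/
theorem exists_mem_mul_left {g : CTree ≃. CTree} (hg : g ∈ GeometryMonoid) {a a' : CTree}
    (h : g a = some a') (b : CTree) : ∃ f ∈ GeometryMonoid, f (a * b) = some (a' * b) := by
  induction hg using Submonoid.closure_induction generalizing a a' with
  | mem f hf =>
    obtain ⟨X, α, rfl | rfl⟩ := hf
    · exact ⟨lawOp X (false :: α), Submonoid.subset_closure ⟨X, _, Or.inl rfl⟩,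
        Option.map_eq_some_iff.2 ⟨a', h, rfl⟩⟩
    · exact ⟨(lawOp X (false :: α)).symm, Submonoid.subset_closure ⟨X, _, Or.inr rfl⟩,
        Option.map_eq_some_iff.2 ⟨a', h, rfl⟩⟩
  | one => cases h; exact ⟨1, one_mem _, rfl⟩
  | mul f g _ _ hf hg =>
    obtain ⟨s, hs, h⟩ := mul_eq_some.1 h
    obtain ⟨f', hf', e⟩ := hf hs
    obtain ⟨g', hg', e'⟩ := hg h
    exact ⟨f' * g', mul_mem hf' hg', mul_eq_some.2 ⟨_, e, e'⟩⟩

theorem exists_mem_comm (a b : CTree) : ∃ f ∈ GeometryMonoid, f (a * b) = some (b * a) :=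
  ⟨lawOp .C [], Submonoid.subset_closure ⟨.C, [], Or.inl rfl⟩, rfl⟩

theorem exists_mem_assoc (a b c : CTree) :
    ∃ f ∈ GeometryMonoid, f (a * b * c) = some (a * (b * c)) :=
  ⟨(lawOp .A []).symm, Submonoid.subset_closure ⟨.A, [], Or.inr rfl⟩, rfl⟩

theorem exists_mem_trans {a b c : CTree} (h₁ : ∃ f ∈ GeometryMonoid, f a = some b)
    (h₂ : ∃ f ∈ GeometryMonoid, f b = some c) : ∃ f ∈ GeometryMonoid, f a = some c := by
  obtain ⟨f, hf, e⟩ := h₁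
  obtain ⟨g, hg, e'⟩ := h₂
  exact ⟨f * g, mul_mem hf hg, mul_eq_some.2 ⟨b, e, e'⟩⟩

/-- Belonging to the same orbit of the geometry monoid, as a congruence on the free magma of
trees. -/
def orbitCon : Con CTree where
  r a b := ∃ f ∈ GeometryMonoid, f a = some b
  iseqv :=
    { refl := fun a => ⟨1, one_mem _, rfl⟩
      symm := fun ⟨f, hf, e⟩ => ⟨f.symm, symm_mem_geometryMonoid hf, (PEquiv.eq_some_iff f).2 e⟩
      trans := exists_mem_trans }
  mul' := by
    rintro a a' b b' ⟨f, hf, e⟩ ⟨g, hg, e'⟩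
    exact exists_mem_trans (exists_mem_mul_left hf e b) <|
      exists_mem_trans (exists_mem_comm a' b) <|
        exists_mem_trans (exists_mem_mul_left hg e' a') (exists_mem_comm b' a')

instance orbitCon.instCommSemigroup : CommSemigroup orbitCon.Quotient where
  mul_assoc x y z := by
    induction x using Con.induction_on with | _ a
    induction y using Con.induction_on with | _ b
    induction z using Con.induction_on with | _ c
    exact (Con.eq _).2 (exists_mem_assoc a b c)
  mul_comm x y := by
    induction x using Con.induction_on with | _ a
    induction y using Con.induction_on with | _ b
    exact (Con.eq _).2 (exists_mem_comm a b)

/-- The orbits form a commutative semigroup, so that the orbit of a tree is the product of the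
orbits of its leaves. -/
theorem coe_orbit_eq_prod (t : CTree) : ((t : orbitCon.Quotient) : WithOne orbitCon.Quotient) =
    ((leaves t).map fun i =>
      (((FreeMagma.of i : CTree) : orbitCon.Quotient) : WithOne orbitCon.Quotient)).prod := by
  induction t with
  | of i => rw [leaves_of, Multiset.map_singleton, Multiset.prod_singleton]
  | mul a b ha hb =>
    rw [leaves_mul, Multiset.map_add, Multiset.prod_add, ← ha, ← hb, ← WithOne.coe_mul,
      ← Con.coe_mul]
    rfl

theorem exists_mem_of_leaves_eq {t t' : CTree} (h : leaves t = leaves t') :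
    ∃ f ∈ GeometryMonoid, f t = some t' := by
  have e := coe_orbit_eq_prod t
  rw [h, ← coe_orbit_eq_prod, WithOne.coe_inj] at e
  exact (Con.eq _).1 e

end CTree

/-! ### The isomorphism between the geometry group and Thompson's group `V` -/

namespace ThompsonV

open CTree
open scoped Stream'

/-- The permutation `00x ↦ 0x`, `01x ↦ 10x`, `1x ↦ 11x`. -/
def rotate : Equiv.Perm (Stream' Bool) where
  toFun x := bif x.head then .cons true x else
    bif x.tail.head then .cons true (.cons false x.tail.tail) else x.tail
  invFun x := bif x.head then
    (bif x.tail.head then x.tail else .cons false (.cons true x.tail.tail)) else .cons false x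
  left_inv x := by
    obtain ⟨_ | _, x, rfl⟩ := exists_cons x <;> obtain ⟨_ | _, x, rfl⟩ := exists_cons x <;> rfl
  right_inv x := by
    obtain ⟨_ | _, x, rfl⟩ := exists_cons x <;> obtain ⟨_ | _, x, rfl⟩ := exists_cons x <;> rfl

/-- The permutation `0x ↦ 1x`, `1x ↦ 0x`. -/
def flip : Equiv.Perm (Stream' Bool) where
  toFun x := .cons (!x.head) x.tail
  invFun x := .cons (!x.head) x.tail
  left_inv x := by obtain ⟨_ | _, x, rfl⟩ := exists_cons x <;> rfl
  right_inv x := by obtain ⟨_ | _, x, rfl⟩ := exists_cons x <;> rfl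

/-- The action of a permutation on the sequences that begin with `d`, after this first digit. -/
def branch (d : Bool) (p : Equiv.Perm (Stream' Bool)) : Equiv.Perm (Stream' Bool) where
  toFun x := bif x.head == d then .cons d (p x.tail) else x
  invFun x := bif x.head == d then .cons d (p.symm x.tail) else x
  left_inv x := by
    obtain ⟨e, x, rfl⟩ := exists_cons x
    cases d <;> cases e <;> simp
  right_inv x := by
    obtain ⟨e, x, rfl⟩ := exists_cons x
    cases d <;> cases e <;> simp

theorem rotate_mem : rotate ∈ ThompsonV := by
  refine ⟨2, fun u hu => ?_⟩
  obtain ⟨a, b, rfl⟩ := List.length_eq_two.1 hu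
  cases a <;> cases b
  exacts [⟨[false], fun _ => rfl⟩, ⟨[true, false], fun _ => rfl⟩,
    ⟨[true, true, false], fun _ => rfl⟩, ⟨[true, true, true], fun _ => rfl⟩]

theorem flip_mem : flip ∈ ThompsonV := by
  refine ⟨1, fun u hu => ?_⟩
  obtain ⟨a, rfl⟩ := List.length_eq_one_iff.1 hu
  exact ⟨[!a], fun _ => rfl⟩

theorem branch_mem (d : Bool) {p : Equiv.Perm (Stream' Bool)} (hp : p ∈ ThompsonV) :
    branch d p ∈ ThompsonV := by
  obtain ⟨N, hN⟩ := hp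
  refine ⟨N + 1, fun u hu => ?_⟩
  rcases u with _ | ⟨e, u⟩
  · simp at hu
  · obtain ⟨v, hv⟩ := hN u (by simpa using hu)
    by_cases h : e = d
    · subst h
      refine ⟨e :: v, fun x => ?_⟩
      change (bif e == e then Stream'.cons e (p (u ++ₛ x)) else _) = Stream'.cons e (v ++ₛ x)
      rw [hv, beq_self_eq_true, cond_true]
    · refine ⟨e :: u, fun x => ?_⟩
      change (bif e == d then Stream'.cons d (p (u ++ₛ x)) else _) = _
      rw [beq_false_of_ne h, cond_false]

/-- A permutation `p` realizes a partial operator `g` if, whenever `g` maps `t` to `t'`, it maps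
the dyadic partition of `t'` to that of `t`. -/
def Realizes (p : Equiv.Perm (Stream' Bool)) (g : CTree ≃. CTree) : Prop :=
  ∀ t t', g t = some t' → ∀ x, t.locate (p x) = t'.locate x

theorem Realizes.symm {p : Equiv.Perm (Stream' Bool)} {g : CTree ≃. CTree} (h : Realizes p g) :
    Realizes p⁻¹ g.symm := by
  intro t t' ht x
  have := h t' t (PEquiv.eq_some_iff _ |>.1 ht) (p⁻¹ x)
  rw [← this, ← Equiv.Perm.mul_apply, mul_inv_cancel, Equiv.Perm.one_apply]

theorem realizes_one : Realizes 1 1 := by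
  rintro t _ ⟨⟩ x
  rfl

theorem Realizes.mul {p q : Equiv.Perm (Stream' Bool)} {f g : CTree ≃. CTree} (hf : Realizes p f)
    (hg : Realizes q g) : Realizes (p * q) (f * g) := by
  intro t t' ht x
  obtain ⟨s, hs, ht⟩ := mul_eq_some.1 ht
  rw [Equiv.Perm.mul_apply, hf t s hs, hg s t' ht]

theorem realizes_assoc : Realizes rotate assoc := by
  intro t t' h x
  obtain ⟨a, b, c, rfl, rfl⟩ := assoc_eq_some h
  obtain ⟨_ | _, x, rfl⟩ := exists_cons x <;> obtain ⟨_ | _, x, rfl⟩ := exists_cons x <;> rfl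

theorem realizes_comm : Realizes flip comm := by
  intro t t' h x
  obtain ⟨a, b, rfl, rfl⟩ := comm_eq_some h
  obtain ⟨_ | _, x, rfl⟩ := exists_cons x <;> rfl

theorem Realizes.onLeft {p : Equiv.Perm (Stream' Bool)} {f : CTree ≃. CTree} (hf : Realizes p f) :
    Realizes (branch false p) (onLeft f) := by
  intro t t' h x
  obtain ⟨a, a', b, ha, rfl, rfl⟩ := onLeft_eq_some h
  obtain ⟨_ | _, x, rfl⟩ := exists_cons x
  exacts [hf a a' ha x, rfl]

theorem Realizes.onRight {p : Equiv.Perm (Stream' Bool)} {f : CTree ≃. CTree} (hf : Realizes p f) :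
    Realizes (branch true p) (onRight f) := by
  intro t t' h x
  obtain ⟨a, b, b', hb, rfl, rfl⟩ := onRight_eq_some h
  obtain ⟨_ | _, x, rfl⟩ := exists_cons x
  exacts [rfl, hf b b' hb x]

theorem exists_realizes_lawOp (X : Law) (α : Address) :
    ∃ p ∈ ThompsonV, Realizes p (lawOp X α) := by
  induction α with
  | nil =>
    cases X
    exacts [⟨rotate, rotate_mem, realizes_assoc⟩, ⟨flip, flip_mem, realizes_comm⟩]
  | cons d α ih =>
    obtain ⟨p, hp, h⟩ := ih
    cases d
    exacts [⟨_, branch_mem false hp, h.onLeft⟩, ⟨_, branch_mem true hp, h.onRight⟩]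

theorem exists_realizes (g : GeometryMonoid) : ∃ p : ThompsonV, Realizes p g := by
  obtain ⟨g, hg⟩ := g
  induction hg using Submonoid.closure_induction with
  | mem f hf =>
    obtain ⟨X, α, rfl | rfl⟩ := hf <;> obtain ⟨p, hp, h⟩ := exists_realizes_lawOp X α
    exacts [⟨⟨p, hp⟩, h⟩, ⟨⟨p⁻¹, inv_mem hp⟩, h.symm⟩]
  | one => exact ⟨1, realizes_one⟩
  | mul f g _ _ hf hg =>
    obtain ⟨p, hp⟩ := hf
    obtain ⟨q, hq⟩ := hg
    exact ⟨p * q, hp.mul hq⟩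

/-- Near-equal operators are realized by at most one permutation: they agree at some tree with
pairwise distinct labels, and such a tree separates the sequences. -/
theorem Realizes.unique {g h : GeometryMonoid} (hgh : NearEq g h) {p q : Equiv.Perm (Stream' Bool)}
    (hp : Realizes p g) (hq : Realizes q h) : p = q := by
  obtain ⟨N, hN⟩ := deepDom_of_mem g.2
  obtain ⟨M, hM⟩ := deepDom_of_mem h.2
  obtain ⟨t, ht, hd, -⟩ := exists_full_nodup (N + M) 1
  obtain ⟨s, hs, -⟩ := hN 0 t (by omega)
  obtain ⟨s', hs', -⟩ := hM 0 t (by omega)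
  have e := hgh.2 t (by simp [hs]) (by simp [hs'])
  rw [hs, hs'] at e
  cases e
  exact Equiv.ext fun x => locate_injective ht ((hp t s hs x).trans (hq t s hs' x).symm)

/-- The homomorphism from the geometry monoid to `V`. -/
noncomputable def ofGeometryMonoid : GeometryMonoid →* ThompsonV where
  toFun g := (exists_realizes g).choose
  map_one' := Subtype.ext <| Realizes.unique (nearEqCon.refl 1) (exists_realizes 1).choose_spec
    realizes_one
  map_mul' f g := Subtype.ext <| Realizes.unique (nearEqCon.refl (f * g))
    (exists_realizes (f * g)).choose_spec
    ((exists_realizes f).choose_spec.mul (exists_realizes g).choose_spec)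

theorem realizes_ofGeometryMonoid (g : GeometryMonoid) : Realizes (ofGeometryMonoid g) g :=
  (exists_realizes g).choose_spec

/-- The homomorphism from the geometry group to `V`. -/
noncomputable def ofGeometryGroup : GeometryGroup →* ThompsonV :=
  nearEqCon.lift ofGeometryMonoid fun g h hgh =>
    Subtype.ext <| Realizes.unique hgh (realizes_ofGeometryMonoid g) (realizes_ofGeometryMonoid h)

theorem ofGeometryGroup_mk (g : GeometryMonoid) :
    ofGeometryGroup (GeometryGroup.mk g) = ofGeometryMonoid g := rfl

theorem ofGeometryGroup_injective : Function.Injective ofGeometryGroup := by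
  rw [injective_iff_map_eq_one]
  intro a ha
  obtain ⟨g, rfl⟩ := GeometryGroup.exists_mk a
  rw [← GeometryGroup.mk_one, GeometryGroup.mk_eq_mk]
  refine ⟨exists_common g.2 (one_mem _), fun t ht _ => ?_⟩
  obtain ⟨t', ht'⟩ := Option.isSome_iff_exists.1 ht
  have h := realizes_ofGeometryMonoid g t t' ht'
  rw [← ofGeometryGroup_mk, ha] at h
  rw [ht', eq_of_locate_eq h]
  rfl

/-- An element `p` of `V` given by a table on the words of length `N` maps the dyadic partition of
a full tree of depth `N` to the dyadic partition of another tree, which has the same leaves. -/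
theorem ofGeometryGroup_surjective : Function.Surjective ofGeometryGroup := by
  rintro ⟨p, hp⟩
  obtain ⟨N, hN⟩ := id hp
  choose v hv using hN
  obtain ⟨M, hM⟩ : ∃ M, ∀ (u : List Bool) (hu : u.length = N), (v u hu).length ≤ M := by
    have := (List.finite_length_eq Bool N).to_subtype
    obtain ⟨M, hM⟩ := (Set.finite_range fun u : {u : List Bool | u.length = N} =>
      (v u.1 u.2).length).bddAbove
    exact ⟨M, fun u hu => hM ⟨⟨u, hu⟩, rfl⟩⟩
  obtain ⟨t', ht', -, -, hloc⟩ := exists_full_nodup N 1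
  obtain ⟨t, ht⟩ := exists_locate_eq_of_prefix M (fun x => t'.locate (p⁻¹ x)) fun w hw => by
    -- The substitute `v` of the first `N` digits of `p⁻¹ (w000…)` is a prefix of `w`.
    set y : Stream' Bool := p⁻¹ (w ++ₛ Stream'.const false) with hy
    have hl : (y.take N).length = N := Stream'.length_take N y
    have hpy : v _ hl ++ₛ y.drop N = w ++ₛ Stream'.const false := by
      rw [← hv, Stream'.append_take_drop, hy, ← Equiv.Perm.mul_apply, mul_inv_cancel,
        Equiv.Perm.one_apply]
    have hle := hM _ hl
    refine ⟨v _ hl, w.drop (v _ hl).length, ?_, ?_⟩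
    · have h₁ := congrArg (Stream'.take (v _ hl).length) hpy
      rw [Stream'.take_append_of_le_length _ _ _ le_rfl,
        Stream'.take_append_of_le_length _ _ _ (by omega), List.take_length] at h₁
      conv_lhs => rw [← List.take_append_drop (v _ hl).length w, ← h₁]
    · obtain ⟨i, hi⟩ := hloc _ hl
      refine ⟨i, fun x => ?_⟩
      rw [← hv _ hl x, ← Equiv.Perm.mul_apply, inv_mul_cancel, Equiv.Perm.one_apply]
      exact hi x
  have htt (x : Stream' Bool) : t.locate (p x) = t'.locate x := by
    rw [ht, ← Equiv.Perm.mul_apply, inv_mul_cancel, Equiv.Perm.one_apply]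
  have hnd : (leaves t).Nodup := nodup_leaves_of_locate_injective fun x y hxy => by
    rw [ht, ht] at hxy
    exact p⁻¹.injective (locate_injective ht' hxy)
  have hleaves : leaves t = leaves t' := (hnd.ext ht').2 fun i => by
    constructor
    · intro hi
      obtain ⟨x, hx⟩ := exists_locate_eq hi (.const true)
      have := locate_fst_mem t' (p⁻¹ x)
      rwa [← ht, hx] at this
    · intro hi
      obtain ⟨x, hx⟩ := exists_locate_eq hi (.const true)
      have := locate_fst_mem t (p x)
      rwa [htt, hx] at this
  obtain ⟨g, hg, e⟩ := exists_mem_of_leaves_eq hleaves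
  refine ⟨GeometryGroup.mk ⟨g, hg⟩, Subtype.ext (Equiv.ext fun x => locate_injective hnd ?_)⟩
  rw [htt]
  exact realizes_ofGeometryMonoid ⟨g, hg⟩ t t' e x

/-- The isomorphism between the geometry group and Thompson's group `V`. -/
noncomputable def equivGeometryGroup : GeometryGroup ≃* ThompsonV :=
  MulEquiv.ofBijective ofGeometryGroup ⟨ofGeometryGroup_injective, ofGeometryGroup_surjective⟩

end ThompsonV

/-- The relations `R_AC` and `C_α² = 1` present the geometry group of associativity and
commutativity on the generators `A_α`, `C_α`, and this group is Thompson's group `V`: the class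
of an operator `g` mapping a tree `t` to a tree `t'` corresponds to the element of `V` that maps
the dyadic partition of `t'` to that of `t`, leaf by leaf according to the labels. -/
theorem proposition3p18 :
    ∃ (φ : PresentedGroup (relatorsAC ∪ torsionRelators) ≃* GeometryGroup)
      (Φ : GeometryGroup ≃* ThompsonV),
      (∀ (X : Law) (α : Address), φ (PresentedGroup.of (X, α)) = GeometryGroup.gen X α) ∧
      (∀ (g : GeometryMonoid) (t t' : CTree), (g : CTree ≃. CTree) t = some t' →
        ∀ x : Stream' Bool,
          t.locate ((Φ (GeometryGroup.mk g) : Equiv.Perm (Stream' Bool)) x) = t'.locate x) :=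
  ⟨ACGroup.equivGeometryGroup, ThompsonV.equivGeometryGroup, ACGroup.toGeometryGroup_of,
    fun g t t' h x => ThompsonV.realizes_ofGeometryMonoid g t t' h x⟩
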